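/- Let $\Gamma$ be a finite simplicial graph and let $A_\Gamma$ be its right-angled Artin group (generated by the vertices of $\Gamma$, with adjacent vertices commuting). For a set $U$ of vertices, let $\Gamma[U]$ be the induced subgraph and $A_U=A_{\Gamma[U]}$. Suppose that $\Gamma$ has diameter at least $3$ (infinite if $\Gamma$ is disconnected) and has a separating simplex $\Delta$, that is, a set of pairwise adjacent vertices such that $\Gamma\setminus\Delta$ is disconnected. Then $A_\Gamma$ is the finitely generated fundamental group of a finite graph of groups whose edge groups have subexponential growth in the ambient word metric, and there is an element of $A_\Gamma$ that is loxodromic and WPD for the action on the Bass–Serre tree. (A subgroup $H<G$ has subexponential growth in the ambient word metric if $n\mapsto\#\{h\in H: d_G(1,h)\le n\}$ is subexponential, for every word metric $d_G$ on $G$ given by a finite generating set. An element $g$ of a group $G$ acting on $X$ is loxodromic if $n\mapsto g^nx_0$ is a quasi-isometric embedding of $\mathbb Z$ in $X$ for every $x_0 \in X$, and WPD if for all $\kappa>0$ and $x_0\in X$ there is $N\in\mathbb N$ such that only finitely many $h\in G$ satisfy $d_X(x_0,hx_0)<\kappa$ and $d_X(g^Nx_0,hg^Nx_0)<\kappa$.)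 More precisely, the natural map $A_\Delta\to A_\Gamma$ is injective, and its image is abelian, undistorted, and of subexponential growth in the ambient word metric. Call a pair $(W_1,W_2)$ of vertex sets a decomposition along $\Delta$ if $W_1\cup W_2$ is the whole vertex set, $W_1\cap W_2=\Delta$, both $W_i\setminus\Delta$ are non-empty, and no vertex of $W_1\setminus\Delta$ is adjacent to a vertex of $W_2\setminus\Delta$. For any vertices $a,b$ in distinct connected components of $\Gamma\setminus\Delta$ there is a decomposition along $\Delta$ with $a\in W_1$ and $b\in W_2$. For every decomposition $(W_1,W_2)$ along $\Delta$, the inclusions induce a splitting $A_\Gamma=A_{W_1}*_{A_\Delta}A_{W_2}$ (a graph of groups with one edge), whose Bass–Serre graph $X$ is a tree, and the following hold. 1. There is an element of $A_\Gamma$ that is loxodromic and WPD for the action on $X$. 2. For all vertices $a\in W_1\setminus\Delta$ and $b\in W_2\setminus\Delta$, the product $ab$ is loxodromic on $X$; if moreover $a$ and $b$ have no common neighbour in $\Gamma$, then $ab$ is WPD. -/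

import Mathlib

open Filter Asymptotics
open scoped commutatorElement

universe u

/-! ### Word metrics, growth, distortion -/

section WordMetric

variable {G : Type*} [Group G]

/-- `d_S(1, g)`: the least length of a word in `S ∪ S⁻¹` that represents `g`.
It is used only for generating sets `S`. -/
noncomputable def wordNorm (S : Set G) (g : G) : ℕ :=
  sInf {n : ℕ | ∃ l : List G, (∀ x ∈ l, x ∈ S ∨ x⁻¹ ∈ S) ∧ l.prod = g ∧ l.length = n}

/-- `S` is a finite generating set of `G`. -/
def IsFiniteGeneratingSet (S : Set G) : Prop :=
  S.Finite ∧ Subgroup.closure S = ⊤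

/-- A function `ℕ → ℕ` is subexponential if it is `o(cⁿ)` for every `c > 1`. -/
def IsSubexponential (ψ : ℕ → ℕ) : Prop :=
  ∀ c : ℝ, 1 < c → (fun n : ℕ => (ψ n : ℝ)) =o[atTop] (fun n : ℕ => c ^ n)

/-- `H` has subexponential growth in the ambient word metric: the function
`ψ(n) = #{h ∈ H : d_G(1, h) ≤ n}` is subexponential, for every word metric on `G` coming from a
finite generating set. (The balls are finite, so `Set.ncard` is the honest cardinality.) -/
def HasAmbientSubexponentialGrowth (H : Subgroup G) : Prop :=
  ∀ S : Set G, IsFiniteGeneratingSet S →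
    IsSubexponential (fun n => {h : G | h ∈ H ∧ wordNorm S h ≤ n}.ncard)

/-- `H` is an undistorted subgroup of `G`: it is finitely generated and, for all word metrics coming
from finite generating sets, its own word metric is bounded above by a linear function of the
ambient one. (The reverse estimate holds for every finitely generated subgroup.) -/
def IsUndistorted (H : Subgroup G) : Prop :=
  H.FG ∧ ∀ (S : Set G) (T : Set H), IsFiniteGeneratingSet S → IsFiniteGeneratingSet T →
    ∃ C : ℕ, ∀ h : H, wordNorm T h ≤ C * wordNorm S (h : G)

end WordMetric

/-! ### Loxodromic and WPD elements for an action on a graph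

A connected graph is regarded as a metric space through the path metric on its vertex set. Every
point of the geometric realization is at distance at most `1/2` from a vertex, so that the two
notions below are the same for the vertex set and for the realization. -/

section Actions

variable {G α : Type*} [Group G] [MulAction G α]

/-- `g` acts loxodromically: `n ↦ gⁿ x₀` is a quasi-isometric embedding of `ℤ`. -/
def IsLoxodromic (X : SimpleGraph α) (g : G) : Prop :=
  ∀ x₀ : α, ∃ A B : ℝ, 1 ≤ A ∧ 0 ≤ B ∧ ∀ m n : ℤ,
    |(m : ℝ) - n| / A - B ≤ (X.dist (g ^ m • x₀) (g ^ n • x₀) : ℝ) ∧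
    (X.dist (g ^ m • x₀) (g ^ n • x₀) : ℝ) ≤ A * |(m : ℝ) - n| + B

/-- `g` satisfies the weak proper discontinuity condition. -/
def IsWPD (X : SimpleGraph α) (g : G) : Prop :=
  ∀ (κ : ℝ) (x₀ : α), 0 < κ → ∃ N : ℕ,
    {h : G | (X.dist x₀ (h • x₀) : ℝ) < κ ∧
      (X.dist (g ^ N • x₀) (h • g ^ N • x₀) : ℝ) < κ}.Finite

end Actions

/-! ### Graphs of groups, their fundamental groups and Bass–Serre trees -/

/-- A graph of groups with vertices `ι` and (unoriented, possibly multiple, possibly loop) edges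
`ε`. Every edge comes with one chosen orientation, from `o e` to `t e`, and its group has a
monomorphism to the group of each end. -/
structure GraphOfGroups (ι ε : Type*) where
  o : ε → ι
  t : ε → ι
  vgrp : ι → Type u
  egrp : ε → Type u
  [vgroup : ∀ i, Group (vgrp i)]
  [egroup : ∀ e, Group (egrp e)]
  toO : ∀ e, egrp e →* vgrp (o e)
  toT : ∀ e, egrp e →* vgrp (t e)
  toO_injective : ∀ e, Function.Injective (toO e)
  toT_injective : ∀ e, Function.Injective (toT e)

namespace GraphOfGroups

variable {ι ε : Type*} (𝒢 : GraphOfGroups.{u} ι ε)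

instance instGroupVgrp (i : ι) : Group (𝒢.vgrp i) := 𝒢.vgroup i

instance instGroupEgrp (e : ε) : Group (𝒢.egrp e) := 𝒢.egroup e

/-- The edges in `T` form a spanning tree of the underlying multigraph: no loops, no multiple
edges, and the resulting simple graph on all the vertices is a tree. -/
structure IsSpanningTree (T : Set ε) : Prop where
  not_loop : ∀ e ∈ T, 𝒢.o e ≠ 𝒢.t e
  injOn : Set.InjOn (fun e => s(𝒢.o e, 𝒢.t e)) T
  isTree : (SimpleGraph.fromEdgeSet ((fun e => s(𝒢.o e, 𝒢.t e)) '' T)).IsTree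

/-- The free product of all the vertex groups with the free group on the edges. -/
abbrev PreGroup : Type _ := Monoid.Coprod (Monoid.CoprodI 𝒢.vgrp) (FreeGroup ε)

/-- The inclusion of a vertex group in the free product. -/
def preVertex (i : ι) : 𝒢.vgrp i →* 𝒢.PreGroup :=
  (Monoid.Coprod.inl).comp (Monoid.CoprodI.of (M := 𝒢.vgrp) (i := i))

/-- The stable letter of an edge in the free product. -/
def preStable (e : ε) : 𝒢.PreGroup := Monoid.Coprod.inr (FreeGroup.of e)

/-- The relators `s_e · toT(c) · s_e⁻¹ · toO(c)⁻¹` for all edges `e`, with `s_e` the stable letter,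
and `s_e` for the edges of `T`. -/
def relators (T : Set ε) : Set 𝒢.PreGroup :=
  {x | ∃ (e : ε) (c : 𝒢.egrp e), x = 𝒢.preStable e * 𝒢.preVertex (𝒢.t e) (𝒢.toT e c) *
      (𝒢.preStable e)⁻¹ * (𝒢.preVertex (𝒢.o e) (𝒢.toO e c))⁻¹} ∪
  {x | ∃ e ∈ T, x = 𝒢.preStable e}

/-- The fundamental group `π₁(𝒢, T)` of the graph of groups with respect to the spanning
tree `T`. -/
def FundGroup (T : Set ε) : Type _ := 𝒢.PreGroup ⧸ Subgroup.normalClosure (𝒢.relators T)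

instance instGroupFundGroup (T : Set ε) : Group (𝒢.FundGroup T) :=
  inferInstanceAs (Group (𝒢.PreGroup ⧸ Subgroup.normalClosure (𝒢.relators T)))

/-- The quotient map onto the fundamental group. -/
def mkFund (T : Set ε) : 𝒢.PreGroup →* 𝒢.FundGroup T :=
  QuotientGroup.mk' (Subgroup.normalClosure (𝒢.relators T))

/-- The canonical map of a vertex group to the fundamental group. -/
def ofVertex (T : Set ε) (i : ι) : 𝒢.vgrp i →* 𝒢.FundGroup T :=
  (𝒢.mkFund T).comp (𝒢.preVertex i)

/-- The stable letter of an edge in the fundamental group. -/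
def stable (T : Set ε) (e : ε) : 𝒢.FundGroup T := 𝒢.mkFund T (𝒢.preStable e)

/-- The image of a vertex group in the fundamental group. -/
def vertexSubgroup (T : Set ε) (i : ι) : Subgroup (𝒢.FundGroup T) := (𝒢.ofVertex T i).range

/-- The image of an edge group in the fundamental group. -/
def edgeSubgroup (T : Set ε) (e : ε) : Subgroup (𝒢.FundGroup T) :=
  ((𝒢.ofVertex T (𝒢.o e)).comp (𝒢.toO e)).range

/-- The vertices of the Bass–Serre tree: the left cosets of the vertex groups. The fundamental
group acts by left multiplication. -/
abbrev BassSerreVertex (T : Set ε) : Type _ :=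
  Σ i : ι, 𝒢.FundGroup T ⧸ 𝒢.vertexSubgroup T i

/-- The Bass–Serre tree: for every edge `e` of the graph of groups and every `g` there is an edge
(the coset of `g` by the edge group) from `g G_{o(e)}` to `g s_e G_{t(e)}`. -/
def bassSerreTree (T : Set ε) : SimpleGraph (𝒢.BassSerreVertex T) :=
  SimpleGraph.fromRel fun x y => ∃ (g : 𝒢.FundGroup T) (e : ε),
    x = ⟨𝒢.o e, (g : 𝒢.FundGroup T ⧸ 𝒢.vertexSubgroup T (𝒢.o e))⟩ ∧
    y = ⟨𝒢.t e, ((g * 𝒢.stable T e : 𝒢.FundGroup T) :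
      𝒢.FundGroup T ⧸ 𝒢.vertexSubgroup T (𝒢.t e))⟩

end GraphOfGroups

/-- `G` is the finitely generated fundamental group of a (finite) graph of groups whose edge groups
have subexponential growth in the ambient word metric, such that some element of `G` is loxodromic
and WPD for the action on the Bass–Serre tree. -/
def SatisfiesGraphAssumption (G : Type u) [Group G] : Prop :=
  Group.FG G ∧
  ∃ (ι ε : Type) (_ : Finite ι) (_ : Finite ε) (𝒢 : GraphOfGroups.{u} ι ε) (T : Set ε)
    (φ : 𝒢.FundGroup T ≃* G),
    𝒢.IsSpanningTree T ∧
    (∀ e, HasAmbientSubexponentialGrowth ((𝒢.edgeSubgroup T e).map φ.toMonoidHom)) ∧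
    ∃ g : G, IsLoxodromic (𝒢.bassSerreTree T) (φ.symm g) ∧ IsWPD (𝒢.bassSerreTree T) (φ.symm g)

/-! ### Right-angled Artin groups -/

/-- The right-angled Artin group of `Γ`: one generator for each vertex, and adjacent vertices
commute. -/
def RAAG {V : Type u} (Γ : SimpleGraph V) : Type u :=
  PresentedGroup {r : FreeGroup V | ∃ v w, Γ.Adj v w ∧ r = ⁅FreeGroup.of v, FreeGroup.of w⁆}

namespace RAAG

variable {V : Type u} (Γ : SimpleGraph V)

instance instGroup : Group (RAAG Γ) :=
  inferInstanceAs (Group (PresentedGroup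
    {r : FreeGroup V | ∃ v w, Γ.Adj v w ∧ r = ⁅FreeGroup.of v, FreeGroup.of w⁆}))

/-- The standard generator of a vertex. -/
def gen (v : V) : RAAG Γ := PresentedGroup.of v

variable {Γ}

theorem gen_commute {v w : V} (h : Γ.Adj v w) : Commute (gen Γ v) (gen Γ w) := by
  have := PresentedGroup.one_of_mem
    (rels := {r : FreeGroup V | ∃ v w, Γ.Adj v w ∧ r = ⁅FreeGroup.of v, FreeGroup.of w⁆})
    (x := ⁅FreeGroup.of v, FreeGroup.of w⁆) ⟨v, w, h, rfl⟩
  rw [map_commutatorElement, commutatorElement_eq_one_iff_commute] at this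
  exact this

/-- The universal property. -/
def lift {H : Type*} [Group H] (f : V → H) (hf : ∀ v w, Γ.Adj v w → Commute (f v) (f w)) :
    RAAG Γ →* H :=
  PresentedGroup.toGroup (f := f) (by
    rintro _ ⟨v, w, h, rfl⟩
    rw [map_commutatorElement, commutatorElement_eq_one_iff_commute]
    simpa using hf v w h)

@[simp] theorem lift_gen {H : Type*} [Group H] (f : V → H)
    (hf : ∀ v w, Γ.Adj v w → Commute (f v) (f w)) (v : V) : lift f hf (gen Γ v) = f v :=
  PresentedGroup.toGroup.of _

theorem hom_ext {H : Type*} [Group H] {f g : RAAG Γ →* H}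
    (h : ∀ v, f (gen Γ v) = g (gen Γ v)) : f = g :=
  PresentedGroup.ext h

variable (Γ)

/-- For `s ⊆ t`, the homomorphism `A_{Γ[s]} → A_{Γ[t]}` of the groups of induced subgraphs that
sends each generator to the generator of the same name. -/
def inclInduce {s t : Set V} (h : s ⊆ t) : RAAG (Γ.induce s) →* RAAG (Γ.induce t) :=
  lift (fun v => gen (Γ.induce t) ⟨v.1, h v.2⟩) fun _ _ hvw => gen_commute hvw

/-- The homomorphism `A_{Γ[s]} → A_Γ` that sends each generator to the generator of the same
name. -/
def incl (s : Set V) : RAAG (Γ.induce s) →* RAAG Γ :=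
  lift (fun v => gen Γ v.1) fun _ _ hvw => gen_commute hvw

open Classical in
theorem inclInduce_injective {s t : Set V} (h : s ⊆ t) :
    Function.Injective (inclInduce Γ h) := by
  let r : RAAG (Γ.induce t) →* RAAG (Γ.induce s) :=
    lift (fun v => if hv : v.1 ∈ s then gen (Γ.induce s) ⟨v.1, hv⟩ else 1) (by
      intro v w hvw
      by_cases hv : v.1 ∈ s
      · by_cases hw : w.1 ∈ s
        · simp only [hv, hw, dite_true]
          exact gen_commute hvw
        · simp only [hw, dite_false]
          exact Commute.one_right _
      · simp only [hv, dite_false]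
        exact Commute.one_left _)
  have hr : r.comp (inclInduce Γ h) = MonoidHom.id _ := by
    apply hom_ext
    intro v
    simp [r, inclInduce]
  exact Function.LeftInverse.injective (g := r) fun x => DFunLike.congr_fun hr x

end RAAG

/-- `Δ` is a separating simplex of `Γ`: its vertices are pairwise adjacent and the subgraph induced
on the complement of `Δ` has at least two connected components. -/
def IsSeparatingSimplex {V : Type u} (Γ : SimpleGraph V) (Δ : Set V) : Prop :=
  Γ.IsClique Δ ∧ ¬ (Γ.induce Δᶜ).Preconnected

/-- `Γ` is the union of the induced subgraphs on `W true` and `W false`, which intersect exactly in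
`Δ`, and neither of which is contained in `Δ`. -/
structure IsDecomposition {V : Type u} (Γ : SimpleGraph V) (Δ : Set V) (W : Bool → Set V) :
    Prop where
  union : W true ∪ W false = Set.univ
  inter : W true ∩ W false = Δ
  nonempty : ∀ i, (W i \ Δ).Nonempty
  not_adj : ∀ v ∈ W true \ Δ, ∀ w ∈ W false \ Δ, ¬ Γ.Adj v w

theorem IsDecomposition.subset {V : Type u} {Γ : SimpleGraph V} {Δ : Set V} {W : Bool → Set V}
    (h : IsDecomposition Γ Δ W) (i : Bool) : Δ ⊆ W i := by
  rw [← h.inter]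
  cases i
  · exact Set.inter_subset_right
  · exact Set.inter_subset_left

/-- The graph of groups with two vertices, carrying the groups of `Γ[W true]` and `Γ[W false]`, and
one edge between them, carrying the group of `Γ[Δ]`; its fundamental group is the amalgamated
product of the vertex groups over the edge group. -/
def raagSplitting {V : Type u} (Γ : SimpleGraph V) {Δ : Set V} {W : Bool → Set V}
    (h : IsDecomposition Γ Δ W) : GraphOfGroups.{u} Bool Unit where
  o _ := true
  t _ := false
  vgrp i := RAAG (Γ.induce (W i))
  egrp _ := RAAG (Γ.induce Δ)
  toO _ := RAAG.inclInduce Γ (h.subset true)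
  toT _ := RAAG.inclInduce Γ (h.subset false)
  toO_injective _ := RAAG.inclInduce_injective Γ (h.subset true)
  toT_injective _ := RAAG.inclInduce_injective Γ (h.subset false)

/-!
The amalgamated subgroup `K = A_Δ` is a finitely generated abelian retract of `A_Γ`. The retraction
makes it undistorted, and the exponent sums of the vertices of `Δ`, which are Lipschitz on all of
`A_Γ` and tell the elements of `K` apart, give polynomial growth in the ambient word metric.

A decomposition `(W₁, W₂)` presents `A_Γ` as the pushout of `A_{W₁}` and `A_{W₂}` over `K`
(`IsDecomposition.exists_hom`). The normal form theorem for pushouts of groups shows that a product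
of elements taken alternately from `A_{W₁} ∖ K` and `A_{W₂} ∖ K` is never trivial
(`IsDecomposition.isAmalgam`). A walk without backtracking in the Bass–Serre graph spells such a
product, so that it does not close up (`IsAmalgam.ne_of_nonbacktracking`). Hence the graph is a
tree, and a product of generators taken alternately from the two sides shifts a geodesic ray and is
loxodromic.

In a tree, an element that shifts a ray is WPD if some segment of the ray has trivial pointwise
stabilizer (`isWPD_of_ray`): an element that moves both ends of a long segment a little keeps the
middle part on the ray. For a product of generators `v₁, …, v_L`, the stabilizer of a period of the
axis lies in `K` and in conjugates of `K`. As the retraction onto `K` kills the `vᵢ`, an element of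
`K` that is conjugated into `K` by `vᵢ` commutes with `vᵢ`, and then involves only vertices of `Δ`
that are adjacent to `vᵢ` (`RAAG.exponent_eq_one_of_commute`). The stabilizer is therefore trivial
if no vertex of `Δ` is adjacent to all the `vᵢ`. This applies to `a b` if `a` and `b` have no common
neighbour. It applies to `x b y b` for suitable `x`, `y` on one side and `b` on the other, because
two vertices of `Γ` are at distance at least three
(`IsDecomposition.exists_no_common_neighbour`); one product of two generators need not be enough, as
every vertex on one side may have a common neighbour with every vertex on the other.
-/

/-! ### Word metrics and homomorphisms -/

section WordMetric

variable {G : Type*} [Group G]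

theorem exists_word_of_closure_eq_top {S : Set G} (hS : Subgroup.closure S = ⊤) (g : G) :
    ∃ l : List G, (∀ x ∈ l, x ∈ S ∨ x⁻¹ ∈ S) ∧ l.prod = g ∧ l.length = wordNorm S g := by
  have hg : g ∈ (Subgroup.closure S).toSubmonoid := hS ▸ Subgroup.mem_top g
  rw [Subgroup.closure_toSubmonoid] at hg
  obtain ⟨l, hl, rfl⟩ := Submonoid.exists_list_of_mem_closure hg
  exact Nat.sInf_mem (s := {n : ℕ | ∃ l' : List G, (∀ x ∈ l', x ∈ S ∨ x⁻¹ ∈ S) ∧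
    l'.prod = l.prod ∧ l'.length = n}) ⟨_, l, hl, rfl, rfl⟩

theorem wordNorm_list_prod_le {S : Set G} {l : List G} (hl : ∀ x ∈ l, x ∈ S ∨ x⁻¹ ∈ S) :
    wordNorm S l.prod ≤ l.length :=
  Nat.sInf_le ⟨l, hl, rfl, rfl⟩

theorem wordNorm_one (S : Set G) : wordNorm S (1 : G) = 0 :=
  Nat.le_zero.mp (wordNorm_list_prod_le (S := S) (l := []) (by simp))

theorem wordNorm_mul_le {S : Set G} (hS : Subgroup.closure S = ⊤) (g h : G) :
    wordNorm S (g * h) ≤ wordNorm S g + wordNorm S h := by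
  obtain ⟨l, hl, hg, hln⟩ := exists_word_of_closure_eq_top hS g
  obtain ⟨l', hl', hh, hln'⟩ := exists_word_of_closure_eq_top hS h
  have := wordNorm_list_prod_le (S := S) (l := l ++ l') fun x hx =>
    (List.mem_append.mp hx).elim (hl x) (hl' x)
  rwa [List.prod_append, hg, hh, List.length_append, hln, hln'] at this

theorem wordNorm_inv_le {S : Set G} (hS : Subgroup.closure S = ⊤) (g : G) :
    wordNorm S g⁻¹ ≤ wordNorm S g := by
  obtain ⟨l, hl, hg, hln⟩ := exists_word_of_closure_eq_top hS g
  have := wordNorm_list_prod_le (S := S) (l := (l.map (·⁻¹)).reverse) fun x hx => by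
    simp only [List.mem_reverse, List.mem_map] at hx
    obtain ⟨y, hy, rfl⟩ := hx
    simpa using (hl y hy).symm
  rwa [← List.prod_inv_reverse, hg, List.length_reverse, List.length_map, hln] at this

/-- A length function on a finitely generated group is bounded above by a multiple of every word
norm: it is bounded on the generators. -/
theorem exists_le_mul_wordNorm {S : Set G} (hS : IsFiniteGeneratingSet S) (f : G → ℕ)
    (h_one : f 1 = 0) (h_mul : ∀ x y, f (x * y) ≤ f x + f y) (h_inv : ∀ x, f x⁻¹ ≤ f x) :
    ∃ C : ℕ, ∀ g, f g ≤ C * wordNorm S g := by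
  obtain ⟨C, hC⟩ := (hS.1.image f).bddAbove
  have hC' : ∀ x ∈ S, f x ≤ C := fun x hx => hC ⟨x, hx, rfl⟩
  refine ⟨C, fun g => ?_⟩
  obtain ⟨l, hl, rfl, hln⟩ := exists_word_of_closure_eq_top hS.2 g
  rw [← hln]
  clear hln
  induction l with
  | nil => simp [h_one]
  | cons x l ih =>
    have hx : f x ≤ C := by
      rcases hl x (by simp) with h | h
      · exact hC' x h
      · simpa using (h_inv x⁻¹).trans (hC' _ h)
    have := ih fun y hy => hl y (by simp [hy])
    rw [List.prod_cons, List.length_cons, Nat.mul_add, Nat.mul_one]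
    have := h_mul x l.prod
    omega

/-- A finitely generated retract is undistorted, since the retraction is Lipschitz. -/
theorem IsUndistorted.of_retraction {H : Subgroup G} (hH : H.FG) (r : G →* H)
    (hr : ∀ h : H, r h = h) : IsUndistorted H := by
  refine ⟨hH, fun S T hS hT => ?_⟩
  obtain ⟨C, hC⟩ := exists_le_mul_wordNorm hS (fun g => wordNorm T (r g))
    (by simp [wordNorm_one]) (fun x y => by simpa using wordNorm_mul_le hT.2 (r x) (r y))
    (fun x => by simpa using wordNorm_inv_le hT.2 (r x))
  exact ⟨C, fun h => by simpa [hr] using hC h⟩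

/-- A subgroup whose elements are told apart by finitely many homomorphisms of the ambient group to
`ℤ` has at most polynomial growth in the ambient word metric. -/
theorem HasAmbientSubexponentialGrowth.of_hom_int {H : Subgroup G} {ι : Type*} [Finite ι]
    (e : ι → G →* Multiplicative ℤ) (he : ∀ h ∈ H, (∀ i, e i h = 1) → h = 1) :
    HasAmbientSubexponentialGrowth H := by
  classical
  intro S hS c hc
  have := Fintype.ofFinite ι
  choose C hC using fun i => exists_le_mul_wordNorm hS (fun g => (e i g).toAdd.natAbs) (by simp)
    (fun x y => by simpa using Int.natAbs_add_le _ _) (fun x => by simp)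
  set D : ℕ := ∑ i, C i with hD
  have hCD : ∀ i, C i ≤ D := fun i => Finset.single_le_sum (f := C) (by simp) (Finset.mem_univ i)
  have hcard : ∀ n, {h : G | h ∈ H ∧ wordNorm S h ≤ n}.ncard ≤
      (2 * (D * n) + 1) ^ Fintype.card ι := by
    intro n
    let F : G → ι → ℤ := fun g i => (e i g).toAdd
    let B : Finset (ι → ℤ) :=
      Fintype.piFinset fun _ => Finset.Icc (-((D * n : ℕ) : ℤ)) ((D * n : ℕ) : ℤ)
    have hmaps : ∀ h ∈ {h : G | h ∈ H ∧ wordNorm S h ≤ n}, F h ∈ (B : Set (ι → ℤ)) := by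
      rintro h ⟨-, hn⟩
      simp only [B, Finset.mem_coe, Fintype.mem_piFinset, Finset.mem_Icc]
      intro i
      have h1 : (F h i).natAbs ≤ D * n := (hC i h).trans (Nat.mul_le_mul (hCD i) hn)
      omega
    have hinj : Set.InjOn F {h : G | h ∈ H ∧ wordNorm S h ≤ n} := by
      rintro x ⟨hx, -⟩ y ⟨hy, -⟩ hxy
      have : x * y⁻¹ = 1 := he _ (H.mul_mem hx (H.inv_mem hy)) fun i => by
        have : e i x = e i y := congrFun hxy i
        rw [map_mul, map_inv, this, mul_inv_cancel]
      exact mul_inv_eq_one.mp this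
    calc _ ≤ (B : Set (ι → ℤ)).ncard := Set.ncard_le_ncard_of_injOn F hmaps hinj B.finite_toSet
      _ = _ := by
        rw [Set.ncard_coe_finset, Fintype.card_piFinset]
        simp only [Int.card_Icc, Finset.prod_const, Finset.card_univ]
        congr 1
        omega
  refine IsBigO.trans_isLittleO ?_ (isLittleO_pow_const_const_pow_of_one_lt (R := ℝ)
    (Fintype.card ι) hc)
  refine IsBigO.of_bound ((2 * D + 1 : ℝ) ^ Fintype.card ι) ?_
  filter_upwards [eventually_ge_atTop 1] with n hn
  rw [Real.norm_natCast, Real.norm_of_nonneg (by positivity), ← mul_pow]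
  refine (Nat.cast_le.mpr (hcard n)).trans ?_
  rw [Nat.cast_pow]
  gcongr
  push_cast
  have : (1 : ℝ) ≤ n := by exact_mod_cast hn
  nlinarith

end WordMetric

/-! ### Rays in trees, loxodromic and WPD elements -/

section Trees

variable {α : Type*} {X : SimpleGraph α}

/-- In a tree, two paths whose ends are close to each other share all the vertices that are far from
the ends. -/
theorem SimpleGraph.IsTree.mem_support_of_dist_lt (hX : X.IsTree) {u v u' v' w : α}
    {p : X.Walk u v} (hp : p.IsPath) (p' : X.Walk u' v') (hw : w ∈ p.support)
    (hu : X.dist u u' < X.dist u w) (hv : X.dist v v' < X.dist v w) : w ∈ p'.support := by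
  classical
  obtain ⟨q, hq⟩ := hX.connected.exists_walk_length_eq_dist u u'
  obtain ⟨r, hr⟩ := hX.connected.exists_walk_length_eq_dist v v'
  have key : ∀ {a b : α} (c : X.Walk a b), c.length = X.dist a b → X.dist a b < X.dist a w →
      w ∉ c.support := fun c hc hlt hmem =>
    absurd ((X.dist_le (c.takeUntil w hmem)).trans (c.length_takeUntil_le_length hmem)) (by omega)
  -- the path `p` is what remains of the detour `u → u' → v' → v` after its loops are cut off
  let s : X.Walk u v := (q.append p').append r.reverse
  have hs : w ∈ s.support := by
    apply s.support_bypass_subset_support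
    rwa [← (hX.existsUnique_path u v).unique hp s.bypass_isPath]
  simp only [s, SimpleGraph.Walk.mem_support_append_iff, SimpleGraph.Walk.support_reverse,
    List.mem_reverse] at hs
  rcases hs with (h | h) | h
  · exact absurd h (key q hq hu)
  · exact h
  · exact absurd h (key r hr hv)

/-- The walk along the first `n` edges of a ray. -/
def rayWalk {p : ℕ → α} (hadj : ∀ n, X.Adj (p n) (p (n + 1))) : ∀ n, X.Walk (p 0) (p n)
  | 0 => .nil
  | n + 1 => (rayWalk hadj n).concat (hadj n)

variable {p : ℕ → α}

theorem length_rayWalk (hadj : ∀ n, X.Adj (p n) (p (n + 1)))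
    (n : ℕ) : (rayWalk hadj n).length = n := by
  induction n with
  | zero => rfl
  | succ n ih => rw [rayWalk, SimpleGraph.Walk.length_concat, ih]

theorem mem_support_rayWalk (hadj : ∀ n, X.Adj (p n) (p (n + 1)))
    {n : ℕ} {w : α} :
    w ∈ (rayWalk hadj n).support ↔ ∃ j ≤ n, p j = w := by
  induction n with
  | zero => simp [rayWalk, eq_comm]
  | succ n ih =>
    rw [rayWalk, SimpleGraph.Walk.support_concat, List.mem_append, ih,
      List.mem_singleton]
    constructor
    · rintro (⟨j, hj, rfl⟩ | rfl)
      · exact ⟨j, by omega, rfl⟩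
      · exact ⟨n + 1, le_rfl, rfl⟩
    · rintro ⟨j, hj, rfl⟩
      rcases Nat.lt_or_ge n j with h | h
      · exact Or.inr (by rw [show j = n + 1 by omega])
      · exact Or.inl ⟨j, h, rfl⟩

theorem isPath_rayWalk (hadj : ∀ n, X.Adj (p n) (p (n + 1)))
    (hp : Function.Injective p) (n : ℕ) : (rayWalk hadj n).IsPath := by
  induction n with
  | zero => exact .nil
  | succ n ih =>
    refine ih.concat (fun h => ?_) (hadj n)
    obtain ⟨j, hj, h⟩ := (mem_support_rayWalk hadj).mp h
    have := hp h
    omega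

theorem SimpleGraph.IsTree.dist_eq_length (hX : X.IsTree) {u v : α} {p : X.Walk u v}
    (hp : p.IsPath) : X.dist u v = p.length := by
  obtain ⟨q, hq, hlen⟩ := hX.connected.exists_path_of_dist u v
  rw [← hlen, (hX.existsUnique_path u v).unique hq hp]

/-- An injective ray in a tree is geodesic. -/
theorem dist_ray_zero (hadj : ∀ n, X.Adj (p n) (p (n + 1)))
    (hX : X.IsTree) (hp : Function.Injective p) (n : ℕ) :
    X.dist (p 0) (p n) = n := by
  rw [hX.dist_eq_length (isPath_rayWalk hadj hp n), length_rayWalk]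

theorem dist_ray (hadj : ∀ n, X.Adj (p n) (p (n + 1)))
    (hX : X.IsTree) (hp : Function.Injective p) (m n : ℕ) :
    X.dist (p m) (p (m + n)) = n :=
  dist_ray_zero (p := fun k => p (m + k)) (fun k => hadj (m + k)) hX
    (fun _ _ h => Nat.add_left_cancel (hp h)) n

/-- Two injective rays in a tree that agree at two indices agree in between. -/
theorem ray_eq_of_ends_eq (hX : X.IsTree) {q : ℕ → α} (hp_adj : ∀ n, X.Adj (p n) (p (n + 1)))
    (hp : Function.Injective p) (hq_adj : ∀ n, X.Adj (q n) (q (n + 1)))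
    (hq : Function.Injective q) {M : ℕ} (h₀ : q 0 = p 0) (hM : q M = p M) {j : ℕ} (hj : j ≤ M) :
    q j = p j := by
  have hpath : ((rayWalk hq_adj M).copy h₀ hM).IsPath := by
    simpa using isPath_rayWalk hq_adj hq M
  have hmem : q j ∈ (rayWalk hp_adj M).support := by
    rw [(hX.existsUnique_path _ _).unique (isPath_rayWalk hp_adj hp M) hpath,
      SimpleGraph.Walk.support_copy]
    exact (mem_support_rayWalk hq_adj).mpr ⟨j, hj, rfl⟩
  obtain ⟨i, -, hi⟩ := (mem_support_rayWalk hp_adj).mp hmem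
  have h1 := dist_ray_zero hp_adj hX hp i
  rw [hi, ← h₀, dist_ray_zero hq_adj hX hq] at h1
  rw [← hi, h1]

variable {G : Type*} [Group G] [MulAction G α]

theorem dist_smul_smul (hX : X.Connected) (hG : ∀ (g : G) {x y}, X.Adj x y → X.Adj (g • x) (g • y))
    (g : G) (x y : α) : X.dist (g • x) (g • y) = X.dist x y := by
  have key : ∀ (g : G) (x y : α), X.dist (g • x) (g • y) ≤ X.dist x y := fun g x y => by
    obtain ⟨w, hw⟩ := hX.exists_walk_length_eq_dist x y
    let f : X →g X := ⟨(g • ·), hG g⟩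
    rw [← hw, ← SimpleGraph.Walk.length_map f]
    exact X.dist_le (w.map f)
  refine le_antisymm (key g x y) ?_
  simpa using key g⁻¹ (g • x) (g • y)

theorem pow_smul_ray {g : G} {L : ℕ} (hg : ∀ n, g • p n = p (n + L)) (k n : ℕ) :
    g ^ k • p n = p (n + k * L) := by
  induction k with
  | zero => simp
  | succ k ih => rw [pow_succ', mul_smul, ih, hg, Nat.succ_mul, Nat.add_assoc]

/-- An automorphism that shifts a ray in a tree by a positive amount is loxodromic. -/
theorem isLoxodromic_of_ray (hadj : ∀ n, X.Adj (p n) (p (n + 1)))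
    (hX : X.IsTree)
    (hG : ∀ (g : G) {x y}, X.Adj x y → X.Adj (g • x) (g • y)) (hp : Function.Injective p)
    {g : G} {L : ℕ} (hL : 0 < L) (hg : ∀ n, g • p n = p (n + L)) : IsLoxodromic X g := by
  have hdist := dist_smul_smul hX.connected hG
  have hpow : ∀ k : ℕ, X.dist (p 0) (g ^ k • p 0) = k * L := fun k => by
    rw [pow_smul_ray hg, Nat.zero_add, dist_ray_zero hadj hX hp]
  have hzpow : ∀ z : ℤ, X.dist (p 0) (g ^ z • p 0) = z.natAbs * L := fun z => by
    obtain ⟨k, rfl | rfl⟩ := z.eq_nat_or_neg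
    · simpa using hpow k
    · rw [← hdist (g ^ (k : ℤ)), smul_smul, ← zpow_add, SimpleGraph.dist_comm]
      simpa using hpow k
  have hmn : ∀ m n : ℤ, X.dist (g ^ m • p 0) (g ^ n • p 0) = (m - n).natAbs * L := fun m n => by
    rw [← hdist (g ^ (-m)), smul_smul, smul_smul, ← zpow_add, ← zpow_add, neg_add_cancel, zpow_zero,
      one_smul, hzpow]
    congr 1
    omega
  intro x₀
  have hL' : (1 : ℝ) ≤ L := by exact_mod_cast hL
  refine ⟨L, 2 * X.dist x₀ (p 0), hL', by positivity, fun m n => ?_⟩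
  have h1 : X.dist (g ^ m • x₀) (g ^ n • x₀) ≤
      X.dist x₀ (p 0) + ((m - n).natAbs * L + X.dist x₀ (p 0)) := by
    refine (hX.connected.dist_triangle (v := g ^ m • p 0)).trans ?_
    rw [hdist]
    refine Nat.add_le_add_left ((hX.connected.dist_triangle (v := g ^ n • p 0)).trans ?_) _
    rw [hmn, hdist, SimpleGraph.dist_comm (u := p 0)]
  have h2 : (m - n).natAbs * L ≤
      X.dist x₀ (p 0) + (X.dist (g ^ m • x₀) (g ^ n • x₀) + X.dist x₀ (p 0)) := by
    rw [← hmn]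
    refine (hX.connected.dist_triangle (v := g ^ m • x₀)).trans ?_
    rw [hdist, SimpleGraph.dist_comm (u := p 0)]
    refine Nat.add_le_add_left ((hX.connected.dist_triangle (v := g ^ n • x₀)).trans ?_) _
    rw [hdist]
  have habs : ((m - n).natAbs : ℝ) = |(m : ℝ) - n| := by
    rw [Nat.cast_natAbs, Int.cast_abs, Int.cast_sub]
  have h1' : (X.dist (g ^ m • x₀) (g ^ n • x₀) : ℝ) ≤
      X.dist x₀ (p 0) + (|(m : ℝ) - n| * L + X.dist x₀ (p 0)) := by
    rw [← habs]; exact_mod_cast h1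
  have h2' : |(m : ℝ) - n| * L ≤
      X.dist x₀ (p 0) + ((X.dist (g ^ m • x₀) (g ^ n • x₀) : ℝ) + X.dist x₀ (p 0)) := by
    rw [← habs]; exact_mod_cast h2
  constructor
  · have h3 : |(m : ℝ) - n| / L ≤ |(m : ℝ) - n| * L :=
      (div_le_self (abs_nonneg _) hL').trans (le_mul_of_one_le_right (abs_nonneg _) hL')
    linarith
  · linarith

/-- An automorphism that shifts a ray in a tree by a positive amount is WPD as soon as some segment
of the ray has trivial pointwise stabilizer: an element that moves both ends of a long segment a
little keeps the middle part on the ray, and is determined by the image of a piece of it. -/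
theorem isWPD_of_ray (hadj : ∀ n, X.Adj (p n) (p (n + 1)))
    (hX : X.IsTree) (hG : ∀ (g : G) {x y}, X.Adj x y → X.Adj (g • x) (g • y))
    (hp : Function.Injective p) {g : G} {L : ℕ} (hL : 0 < L) (hg : ∀ n, g • p n = p (n + L))
    {M : ℕ} (hM : ∀ h : G, h • p 0 = p 0 → h • p M = p M → h = 1) : IsWPD X g := by
  intro κ x₀ _
  have hdist := dist_smul_smul hX.connected hG
  obtain ⟨R, hR⟩ := exists_nat_ge (κ + 2 * X.dist x₀ (p 0))
  have hmove : ∀ k h : G, (X.dist (k • x₀) (h • k • x₀) : ℝ) < κ →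
      X.dist (h • k • p 0) (k • p 0) < R := fun k h hk => by
    have h1 : X.dist (h • k • p 0) (k • p 0) ≤
        X.dist x₀ (p 0) + (X.dist (k • x₀) (h • k • x₀) + X.dist x₀ (p 0)) := by
      refine (hX.connected.dist_triangle (v := h • k • x₀)).trans ?_
      rw [hdist, hdist, SimpleGraph.dist_comm (u := p 0)]
      refine Nat.add_le_add_left ((hX.connected.dist_triangle (v := k • x₀)).trans ?_) _
      rw [hdist, SimpleGraph.dist_comm (u := h • k • x₀)]
    have h1' : (X.dist (h • k • p 0) (k • p 0) : ℝ) ≤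
        X.dist x₀ (p 0) + (X.dist (k • x₀) (h • k • x₀) + X.dist x₀ (p 0)) := by exact_mod_cast h1
    have : (X.dist (h • k • p 0) (k • p 0) : ℝ) < R := by linarith
    exact_mod_cast this
  have hRL : R ≤ R * L := Nat.le_mul_of_pos_right R hL
  have hML : M ≤ M * L := Nat.le_mul_of_pos_right M hL
  -- with this `N`, the segment from `p (R * L)` to `p (M + R * L)` is at distance at least `R` from
  -- both `p 0` and `p (N * L) = g ^ N • p 0`
  set N := 2 * R + M with hN
  have hNL : N * L = R * L + R * L + M * L := by rw [hN]; ring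
  refine ⟨N, ?_⟩
  set E := {h : G | (X.dist x₀ (h • x₀) : ℝ) < κ ∧
    (X.dist (g ^ N • x₀) (h • g ^ N • x₀) : ℝ) < κ} with hE
  have hmid : ∀ h ∈ E, ∀ s, R ≤ s → s + R ≤ N * L → h • p s ∈ p '' Set.Iic (N * L) := by
    rintro h ⟨h₁, h₂⟩ s hs hs'
    have hadj' : ∀ n, X.Adj (h • p n) (h • p (n + 1)) := fun n => hG h (hadj n)
    have hp' : Function.Injective fun n => h • p n := (MulAction.injective h).comp hp
    have hu := hmove 1 h (by simpa using h₁)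
    have hv := hmove (g ^ N) h h₂
    rw [one_smul] at hu
    rw [pow_smul_ray hg, Nat.zero_add] at hv
    have hmem := hX.mem_support_of_dist_lt (isPath_rayWalk hadj' hp' (N * L)) (rayWalk hadj (N * L))
      ((mem_support_rayWalk hadj').mpr ⟨s, by omega, rfl⟩)
      (by rw [hdist _ (p 0) (p s), dist_ray_zero hadj hX hp]; omega)
      (by
        rw [hdist _ (p (N * L)) (p s), SimpleGraph.dist_comm (u := p (N * L)),
          show N * L = s + (N * L - s) by omega, dist_ray hadj hX hp]
        rw [show s + (N * L - s) = N * L by omega]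
        omega)
    exact (mem_support_rayWalk hadj).mp hmem
  have hfin : (p '' Set.Iic (N * L)).Finite := (Set.finite_Iic _).image _
  refine Set.Finite.of_injOn (f := fun h : G => (h • p (R * L), h • p (M + R * L)))
    (t := (p '' Set.Iic (N * L)) ×ˢ (p '' Set.Iic (N * L))) ?_ ?_ (hfin.prod hfin)
  · intro h hh
    exact ⟨hmid h hh _ hRL (by omega), hmid h hh _ (by omega) (by omega)⟩
  · intro h _ h' _ heq
    simp only [Prod.mk.injEq] at heq
    have e₁ : p (R * L) = g ^ R • p 0 := by rw [pow_smul_ray hg, Nat.zero_add]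
    have e₂ : p (M + R * L) = g ^ R • p M := by rw [pow_smul_ray hg]
    rw [e₁, e₂] at heq
    have := hM ((g ^ R)⁻¹ * (h⁻¹ * h') * g ^ R)
      (by rw [mul_smul, mul_smul, mul_smul, ← heq.1, inv_smul_smul, inv_smul_smul])
      (by rw [mul_smul, mul_smul, mul_smul, ← heq.2, inv_smul_smul, inv_smul_smul])
    have h1 : h⁻¹ * h' = 1 := by
      rw [mul_assoc, inv_mul_eq_one] at this
      exact right_eq_mul.mp this
    exact inv_mul_eq_one.mp h1

end Trees

/-! ### The coset graph of an amalgam of two subgroups -/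

section CosetGraph

variable {G : Type*} [Group G] (H : Bool → Subgroup G)

/-- `x` is a product `c₁ ⋯ cₙ` whose factors lie alternately in `H i` and `H (!i)`, starting with
`H i`, and none of which lies in `H true ∩ H false`. -/
def IsAlternatingProd : Bool → ℕ → G → Prop
  | _, 0, x => x = 1
  | i, n + 1, x => ∃ c y, c ∈ H i ∧ c ∉ H (!i) ∧ IsAlternatingProd (!i) n y ∧ x = c * y

/-- `G` is generated by `H true` and `H false`, and no alternating product of positive length is
trivial. This says that `G` is the amalgamated product of the two subgroups along their
intersection. -/
structure IsAmalgam : Prop where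
  sup_eq_top : H true ⊔ H false = ⊤
  not_isAlternatingProd_one : ∀ i n, ¬ IsAlternatingProd H i (n + 1) 1

/-- The graph whose vertices are the left cosets of the two subgroups, and whose edges join the two
cosets of each element of the group. -/
def cosetGraph : SimpleGraph (Σ i, G ⧸ H i) where
  Adj x y := ∃ (i : Bool) (g : G), x = ⟨i, g⟩ ∧ y = ⟨!i, g⟩
  symm := by
    constructor
    rintro _ _ ⟨i, g, rfl, rfl⟩
    exact ⟨!i, g, rfl, by rw [Bool.not_not]⟩
  loopless := by
    constructor
    rintro _ ⟨i, g, rfl, h⟩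
    exact Bool.not_ne_self i (congrArg Sigma.fst h).symm

variable {H}

theorem cosetGraph_adj {x y : Σ i, G ⧸ H i} :
    (cosetGraph H).Adj x y ↔ ∃ (i : Bool) (g : G), x = ⟨i, g⟩ ∧ y = ⟨!i, g⟩ := Iff.rfl

theorem cosetVertex_eq_iff {i j : Bool} {g h : G} :
    (⟨i, g⟩ : Σ i, G ⧸ H i) = ⟨j, h⟩ ↔ i = j ∧ g⁻¹ * h ∈ H j := by
  constructor
  · intro e
    obtain rfl : i = j := congrArg Sigma.fst e
    exact ⟨rfl, QuotientGroup.eq.mp (eq_of_heq (Sigma.mk.inj e).2)⟩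
  · rintro ⟨rfl, e⟩
    rw [QuotientGroup.eq.mpr e]

theorem cosetGraph_adj_smul (g : G) {x y : Σ i, G ⧸ H i} (h : (cosetGraph H).Adj x y) :
    (cosetGraph H).Adj (g • x) (g • y) := by
  obtain ⟨i, k, rfl, rfl⟩ := h
  exact ⟨i, g * k, rfl, rfl⟩

/-- A walk without backtracking in the coset graph spells an alternating product. -/
theorem exists_isAlternatingProd (n : ℕ) : ∀ (v : ℕ → Σ i, G ⧸ H i),
    (∀ k ≤ n, (cosetGraph H).Adj (v k) (v (k + 1))) → (∀ k < n, v k ≠ v (k + 2)) →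
    ∀ (i : Bool) (g : G), v 0 = ⟨i, g⟩ → v 1 = ⟨!i, g⟩ →
      ∃ (x : G) (j : Bool), IsAlternatingProd H (!i) n x ∧ v (n + 1) = ⟨j, (g * x : G)⟩ := by
  induction n with
  | zero => exact fun v _ _ i g _ h₁ => ⟨1, !i, rfl, by rw [h₁, mul_one]⟩
  | succ n ih =>
    intro v hadj hne i g h₀ h₁
    obtain ⟨j, g', e₁, e₂⟩ := hadj 1 (by omega)
    have e := h₁.symm.trans e₁
    obtain ⟨rfl, hc⟩ := cosetVertex_eq_iff.mp e
    obtain ⟨x, j, hx, hv⟩ := ih (fun k => v (k + 1)) (fun k hk => hadj (k + 1) (by omega))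
      (fun k hk => hne (k + 1) (by omega)) (!i) g' e₁ e₂
    refine ⟨g⁻¹ * g' * x, j, ⟨g⁻¹ * g', x, hc, fun hc' => ?_, hx, rfl⟩, ?_⟩
    · refine hne 0 (by omega) ?_
      rw [h₀, e₂, cosetVertex_eq_iff]
      exact ⟨(Bool.not_not i).symm, hc'⟩
    · rw [hv, mul_assoc, mul_inv_cancel_left]

namespace IsAmalgam

variable (hH : IsAmalgam H)
include hH

/-- A walk without backtracking in the coset graph of an amalgam does not close up. -/
theorem ne_of_nonbacktracking {v : ℕ → Σ i, G ⧸ H i} {n : ℕ}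
    (hadj : ∀ k ≤ n, (cosetGraph H).Adj (v k) (v (k + 1))) (hne : ∀ k < n, v k ≠ v (k + 2)) :
    v 0 ≠ v (n + 1) := by
  intro h
  obtain ⟨i, g, h₀, h₁⟩ := hadj 0 (by omega)
  obtain ⟨x, j, hx, hv⟩ := exists_isAlternatingProd n v hadj hne i g h₀ h₁
  rw [h₀, hv] at h
  obtain ⟨rfl, hxi⟩ := cosetVertex_eq_iff.mp h
  rw [inv_mul_cancel_left] at hxi
  by_cases hxi' : x ∈ H (!i)
  · cases n with
    | zero =>
      obtain rfl : x = 1 := hx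
      rw [zero_add, h₁] at hv
      exact Bool.not_ne_self i (congrArg Sigma.fst hv)
    | succ n =>
      -- `x⁻¹ * x = 1` is alternating once `x⁻¹` is absorbed in the first factor of `x`
      obtain ⟨c, y, hc, hc', hy, rfl⟩ := hx
      refine hH.not_isAlternatingProd_one (!i) n ⟨(c * y)⁻¹ * c, y,
        (H (!i)).mul_mem ((H (!i)).inv_mem hxi') hc, fun hmem => hc' ?_, hy, by group⟩
      rw [Bool.not_not] at hmem ⊢
      exact ((H i).mul_mem_cancel_left ((H i).inv_mem hxi)).mp hmem
  · exact hH.not_isAlternatingProd_one i n ⟨x⁻¹, x, (H i).inv_mem hxi,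
      fun hmem => hxi' (by simpa using hmem), hx, by group⟩

theorem connected_cosetGraph : (cosetGraph H).Connected := by
  let X := cosetGraph H
  have hsmul : ∀ (g : G) {x y}, X.Reachable x y → X.Reachable (g • x) (g • y) := fun g x y h =>
    h.map (⟨(g • ·), cosetGraph_adj_smul g⟩ : X →g X)
  let b : Σ i, G ⧸ H i := ⟨true, (1 : G)⟩
  have hedge : ∀ (g : G) (i : Bool), X.Reachable (⟨true, (g : G)⟩ : Σ i, G ⧸ H i) ⟨i, (g : G)⟩ := by
    intro g i
    cases i
    · exact SimpleGraph.Adj.reachable ⟨true, g, rfl, rfl⟩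
    · exact .refl _
  let S : Subgroup G :=
    { carrier := {g | X.Reachable b (g • b)}
      one_mem' := by simp
      mul_mem' := fun {g h} hg hh => by
        rw [Set.mem_ofPred_eq, mul_smul]
        exact SimpleGraph.Reachable.trans hg (hsmul g hh)
      inv_mem' := fun {g} hg => by
        simpa using (hsmul g⁻¹ hg).symm }
  have hle : ∀ i, H i ≤ S := fun i h hh => by
    have e : (⟨i, (1 : G)⟩ : Σ i, G ⧸ H i) = ⟨i, (h : G)⟩ :=
      cosetVertex_eq_iff.mpr ⟨rfl, by simpa using hh⟩
    have h1 := (hedge 1 i)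
    rw [e] at h1
    have h2 : h • b = ⟨true, (h : G)⟩ := by
      change (⟨true, ((h * 1 : G) : G ⧸ H true)⟩ : Σ i, G ⧸ H i) = _
      rw [mul_one]
    change X.Reachable b (h • b)
    rw [h2]
    exact h1.trans (hedge h i).symm
  have hS : S = ⊤ := top_le_iff.mp (hH.sup_eq_top ▸ sup_le (hle true) (hle false))
  rw [SimpleGraph.connected_iff_exists_forall_reachable]
  refine ⟨b, ?_⟩
  rintro ⟨i, x⟩
  induction x using QuotientGroup.induction_on with
  | H g =>
    have hg : X.Reachable b (g • b) := (hS ▸ Subgroup.mem_top g : g ∈ S)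
    have h2 : g • b = ⟨true, (g : G)⟩ := by
      change (⟨true, ((g * 1 : G) : G ⧸ H true)⟩ : Σ i, G ⧸ H i) = _
      rw [mul_one]
    rw [h2] at hg
    exact hg.trans (hedge g i)

theorem isTree_cosetGraph : (cosetGraph H).IsTree := by
  refine ⟨hH.connected_cosetGraph, fun a c hc => ?_⟩
  have hlen := hc.three_le_length
  refine hH.ne_of_nonbacktracking (v := c.getVert) (n := c.length - 1)
    (fun k hk => c.adj_getVert_succ (by omega)) (fun k hk h => ?_) ?_
  · rcases Nat.eq_zero_or_pos k with rfl | hk0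
    · have h' : c.getVert c.length = c.getVert (0 + 2) :=
        c.getVert_length.trans (c.getVert_zero.symm.trans h)
      have := hc.getVert_injOn (by simp; omega) (by simp; omega) h'
      omega
    · have := hc.getVert_injOn (by simp; omega) (by simp; omega) h
      omega
  · rw [show c.length - 1 + 1 = c.length by omega, c.getVert_zero, c.getVert_length]

end IsAmalgam

/-- The product of the first `n` terms of a sequence in a group. -/
def prefixProd (c : ℕ → G) : ℕ → G
  | 0 => 1
  | n + 1 => prefixProd c n * c n

theorem prefixProd_add {c : ℕ → G} {L : ℕ} (hc : ∀ n, c (n + L) = c n) (n : ℕ) :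
    prefixProd c (n + L) = prefixProd c L * prefixProd c n := by
  induction n with
  | zero => simp [prefixProd]
  | succ n ih => rw [Nat.succ_add, prefixProd, ih, hc, mul_assoc, prefixProd]

/-- The `n`-th vertex of the ray spelled by a sequence of letters `c`, where `c n` lies in
`H (s n)` and `s` alternates. The `n`-th edge of the ray, from the `n`-th vertex to the next one, is
the edge of the element `c 0 ⋯ c (n - 1)`. -/
def letterRay (H : Bool → Subgroup G) (s : ℕ → Bool) (c : ℕ → G) (n : ℕ) : Σ i, G ⧸ H i :=
  ⟨!s n, (prefixProd c n : G)⟩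

section LetterRay

variable {s : ℕ → Bool} {c : ℕ → G} (hs : ∀ n, s (n + 1) = !s n) (hc : ∀ n, c n ∈ H (s n))
  (hc' : ∀ n, c n ∉ H (!s n))

include hs hc in
theorem letterRay_succ (n : ℕ) : letterRay H s c (n + 1) = ⟨s n, (prefixProd c n : G)⟩ := by
  rw [letterRay, cosetVertex_eq_iff, hs, Bool.not_not, prefixProd]
  exact ⟨rfl, by simpa using hc n⟩

include hs hc in
theorem letterRay_adj (n : ℕ) : (cosetGraph H).Adj (letterRay H s c n) (letterRay H s c (n + 1)) :=
  ⟨!s n, prefixProd c n, rfl, by rw [letterRay_succ hs hc, Bool.not_not]⟩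

include hs hc hc' in
theorem letterRay_injective (hH : IsAmalgam H) : Function.Injective (letterRay H s c) := by
  have hne : ∀ n, letterRay H s c n ≠ letterRay H s c (n + 2) := fun n h => by
    rw [letterRay_succ hs hc, letterRay, cosetVertex_eq_iff, hs, prefixProd] at h
    exact hc' n (by simpa using h.2)
  have key : ∀ m k, letterRay H s c m ≠ letterRay H s c (m + (k + 1)) := fun m k =>
    hH.ne_of_nonbacktracking (v := fun j => letterRay H s c (m + j)) (n := k)
      (fun j _ => letterRay_adj hs hc (m + j)) (fun j _ => hne (m + j))
  intro m n h
  rcases lt_trichotomy m n with hlt | rfl | hlt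
  · obtain ⟨k, rfl⟩ := Nat.exists_eq_add_of_lt hlt
    exact absurd h (key m k)
  · rfl
  · obtain ⟨k, rfl⟩ := Nat.exists_eq_add_of_lt hlt
    exact absurd h.symm (key n k)

variable {L : ℕ} (hL : 0 < L) (hsL : ∀ n, s (n + L) = s n) (hcL : ∀ n, c (n + L) = c n)

include hsL hcL in
theorem prefixProd_smul_letterRay (n : ℕ) :
    prefixProd c L • letterRay H s c n = letterRay H s c (n + L) := by
  rw [letterRay, letterRay, hsL, prefixProd_add hcL]
  rfl

include hs hc hc' hL hsL hcL in
/-- A cyclically reduced product of even length in an amalgam is loxodromic. -/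
theorem isLoxodromic_prefixProd (hH : IsAmalgam H) :
    IsLoxodromic (cosetGraph H) (prefixProd c L) :=
  isLoxodromic_of_ray (letterRay_adj hs hc) hH.isTree_cosetGraph cosetGraph_adj_smul
    (letterRay_injective hs hc hc' hH) hL (prefixProd_smul_letterRay hsL hcL)

include hs hc hc' hL hsL hcL in
/-- A cyclically reduced product of even length in an amalgam is WPD if the amalgamated subgroup
`K` meets `cₙ K cₙ⁻¹` only in elements that commute with the letter `cₙ`, and only the trivial
element of `K` commutes with all the letters: a period of the axis, with one more edge, then has
trivial pointwise stabilizer. -/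
theorem isWPD_prefixProd (hH : IsAmalgam H)
    (hcomm : ∀ n k, (∀ i, k ∈ H i) → (∀ i, (c n)⁻¹ * k * c n ∈ H i) → (c n)⁻¹ * k * c n = k)
    (htriv : ∀ k, (∀ i, k ∈ H i) → (∀ n < L, Commute k (c n)) → k = 1) :
    IsWPD (cosetGraph H) (prefixProd c L) := by
  have hadj := letterRay_adj hs hc
  have hinj := letterRay_injective hs hc hc' hH
  refine isWPD_of_ray hadj hH.isTree_cosetGraph cosetGraph_adj_smul
    hinj hL (prefixProd_smul_letterRay hsL hcL) (M := L + 1) fun h h₀ hM => ?_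
  have hfix : ∀ j ≤ L + 1, h • letterRay H s c j = letterRay H s c j := fun j hj =>
    ray_eq_of_ends_eq (q := fun n => h • letterRay H s c n) hH.isTree_cosetGraph hadj hinj
      (fun n => cosetGraph_adj_smul h (hadj n)) ((MulAction.injective h).comp hinj) h₀ hM hj
  have hmem : ∀ (g : G) (i : Bool), h • (⟨i, (g : G)⟩ : Σ i, G ⧸ H i) = ⟨i, (g : G)⟩ →
      g⁻¹ * h * g ∈ H i := fun g i e => by
    have e' := (cosetVertex_eq_iff.mp (show (⟨i, ((h * g : G) : G ⧸ H i)⟩ : Σ i, G ⧸ H i) = _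
      from e)).2
    simpa [mul_assoc] using (H i).inv_mem e'
  have hK : ∀ j ≤ L, ∀ i, (prefixProd c j)⁻¹ * h * prefixProd c j ∈ H i := fun j hj i => by
    have e₁ := hfix j (by omega)
    have e₂ := hfix (j + 1) (by omega)
    rw [letterRay_succ hs hc] at e₂
    rw [letterRay] at e₁
    by_cases hi : i = s j
    · exact hi ▸ hmem _ _ e₂
    · exact Bool.eq_not.mpr hi ▸ hmem _ _ e₁
  have hconj : ∀ j ≤ L, (prefixProd c j)⁻¹ * h * prefixProd c j = h := by
    intro j
    induction j with
    | zero => simp [prefixProd]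
    | succ j ih =>
      intro hj
      have e : (prefixProd c (j + 1))⁻¹ * h * prefixProd c (j + 1) =
          (c j)⁻¹ * ((prefixProd c j)⁻¹ * h * prefixProd c j) * c j := by
        rw [prefixProd]; group
      have h1 := hK (j + 1) hj
      rw [e, ih (by omega)] at h1
      rw [e, ih (by omega)]
      refine hcomm j h (fun i => ?_) h1
      simpa [prefixProd] using hK 0 (Nat.zero_le _) i
  refine htriv h (fun i => by simpa [prefixProd] using hK 0 (Nat.zero_le _) i) fun n hn => ?_
  have e₁ := hconj n hn.le
  have e₂ := hconj (n + 1) hn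
  have e : (prefixProd c (n + 1))⁻¹ * h * prefixProd c (n + 1) =
      (c n)⁻¹ * ((prefixProd c n)⁻¹ * h * prefixProd c n) * c n := by
    rw [prefixProd]; group
  rw [e, e₁, mul_assoc, inv_mul_eq_iff_eq_mul] at e₂
  exact e₂

end LetterRay

end CosetGraph

/-! ### Retractions and exponents of right-angled Artin groups -/

namespace RAAG

variable {V : Type u} (Γ : SimpleGraph V)

theorem closure_range_gen : Subgroup.closure (Set.range (gen Γ)) = ⊤ :=
  PresentedGroup.closure_range_of _

theorem fg [Finite V] : Group.FG (RAAG Γ) :=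
  Group.fg_iff.mpr ⟨_, closure_range_gen Γ, Set.finite_range _⟩

@[simp] theorem incl_gen (s : Set V) (v : s) : incl Γ s (gen (Γ.induce s) v) = gen Γ v :=
  lift_gen ..

@[simp] theorem inclInduce_gen {s t : Set V} (h : s ⊆ t) (v : s) :
    inclInduce Γ h (gen (Γ.induce s) v) = gen (Γ.induce t) ⟨v, h v.2⟩ :=
  lift_gen ..

theorem incl_inclInduce {s t : Set V} (h : s ⊆ t) (x : RAAG (Γ.induce s)) :
    incl Γ t (inclInduce Γ h x) = incl Γ s x :=
  DFunLike.congr_fun (hom_ext (f := (incl Γ t).comp (inclInduce Γ h)) fun v => by simp) x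

open Classical in
/-- The retraction of `A_Γ` onto the group of an induced subgraph that kills the other
generators. -/
noncomputable def retract (s : Set V) : RAAG Γ →* RAAG (Γ.induce s) :=
  lift (fun v => if hv : v ∈ s then gen (Γ.induce s) ⟨v, hv⟩ else 1) fun v w hvw => by
    split_ifs
    · exact gen_commute hvw
    · exact Commute.one_right _
    · exact Commute.one_left _
    · exact Commute.one_left _

theorem retract_gen_of_mem {s : Set V} {v : V} (hv : v ∈ s) :
    retract Γ s (gen Γ v) = gen (Γ.induce s) ⟨v, hv⟩ := by
  rw [retract, lift_gen, dif_pos hv]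

theorem retract_gen_of_notMem {s : Set V} {v : V} (hv : v ∉ s) : retract Γ s (gen Γ v) = 1 := by
  rw [retract, lift_gen, dif_neg hv]

theorem retract_incl (s : Set V) (x : RAAG (Γ.induce s)) : retract Γ s (incl Γ s x) = x :=
  DFunLike.congr_fun (hom_ext (f := (retract Γ s).comp (incl Γ s)) (g := MonoidHom.id _)
    fun v => by simp [retract_gen_of_mem Γ v.2]) x

theorem incl_injective (s : Set V) : Function.Injective (incl Γ s) :=
  Function.LeftInverse.injective (retract_incl Γ s)

theorem incl_retract_of_mem {s : Set V} {x : RAAG Γ} (hx : x ∈ (incl Γ s).range) :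
    incl Γ s (retract Γ s x) = x := by
  obtain ⟨y, rfl⟩ := hx
  rw [retract_incl]

theorem range_incl_mono {s t : Set V} (h : s ⊆ t) : (incl Γ s).range ≤ (incl Γ t).range := by
  rintro _ ⟨x, rfl⟩
  exact ⟨_, incl_inclInduce Γ h x⟩

/-- The composition of the retractions onto two subgraphs is the retraction onto their
intersection, so that the subgroups intersect in the group of the intersection. -/
theorem mem_range_incl_inter {s t : Set V} {x : RAAG Γ} (hs : x ∈ (incl Γ s).range)
    (ht : x ∈ (incl Γ t).range) : x ∈ (incl Γ (s ∩ t)).range := by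
  have e : ((incl Γ s).comp (retract Γ s)).comp ((incl Γ t).comp (retract Γ t)) =
      (incl Γ (s ∩ t)).comp (retract Γ (s ∩ t)) := hom_ext fun v => by
    by_cases hvt : v ∈ t
    · by_cases hvs : v ∈ s
      · simp [retract_gen_of_mem, hvt, hvs]
      · simp [retract_gen_of_mem, retract_gen_of_notMem, hvt, hvs]
    · simp [retract_gen_of_notMem, hvt]
  have := DFunLike.congr_fun e x
  simp only [MonoidHom.comp_apply, incl_retract_of_mem Γ ht, incl_retract_of_mem Γ hs] at this
  exact ⟨_, this.symm⟩

/-- An element of `A_s` that is conjugated into `A_s` by a generator outside `s` commutes with that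
generator, because the retraction onto `A_s` kills the generator. -/
theorem conj_gen_eq_of_mem {s : Set V} {a : V} (ha : a ∉ s) {k : RAAG Γ}
    (hk : k ∈ (incl Γ s).range) (hk' : (gen Γ a)⁻¹ * k * gen Γ a ∈ (incl Γ s).range) :
    (gen Γ a)⁻¹ * k * gen Γ a = k := by
  have : retract Γ s ((gen Γ a)⁻¹ * k * gen Γ a) = retract Γ s k := by
    simp [retract_gen_of_notMem Γ ha]
  rw [← incl_retract_of_mem Γ hk', this, incl_retract_of_mem Γ hk]

open Classical in
/-- The exponent sum of a generator. -/
noncomputable def exponent (v : V) : RAAG Γ →* Multiplicative ℤ :=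
  lift (fun w => if w = v then Multiplicative.ofAdd 1 else 1) fun _ _ _ => Commute.all _ _

theorem exponent_gen_self (v : V) : exponent Γ v (gen Γ v) = Multiplicative.ofAdd 1 := by
  rw [exponent, lift_gen, if_pos rfl]

theorem exponent_gen_of_ne {v w : V} (h : w ≠ v) : exponent Γ v (gen Γ w) = 1 := by
  rw [exponent, lift_gen, if_neg h]

theorem gen_ne_one (v : V) : gen Γ v ≠ 1 := fun h => by
  have := exponent_gen_self Γ v
  rw [h, map_one] at this
  exact absurd (congrArg Multiplicative.toAdd this) (by simp)

theorem gen_mem_range_incl {s : Set V} {v : V} (hv : v ∈ s) : gen Γ v ∈ (incl Γ s).range :=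
  ⟨gen _ ⟨v, hv⟩, by simp⟩

theorem gen_notMem_range_incl {s : Set V} {v : V} (hv : v ∉ s) :
    gen Γ v ∉ (incl Γ s).range := fun h => by
  have := incl_retract_of_mem Γ h
  rw [retract_gen_of_notMem Γ hv, map_one] at this
  exact gen_ne_one Γ v this.symm

theorem exponent_incl {s : Set V} (v : s) (x : RAAG (Γ.induce s)) :
    exponent Γ v (incl Γ s x) = exponent (Γ.induce s) v x := by
  refine DFunLike.congr_fun (hom_ext (f := (exponent Γ v).comp (incl Γ s)) fun w => ?_) x
  rw [MonoidHom.comp_apply, incl_gen]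
  by_cases h : w = v
  · rw [h, exponent_gen_self, exponent_gen_self]
  · rw [exponent_gen_of_ne _ h, exponent_gen_of_ne _ fun h' => h (Subtype.ext h')]

variable {Γ}

theorem mul_comm_of_forall_adj (hΓ : ∀ v w, v ≠ w → Γ.Adj v w) (x y : RAAG Γ) :
    x * y = y * x := by
  have h1 : ∀ v w, gen Γ v * gen Γ w = gen Γ w * gen Γ v := fun v w => by
    by_cases h : v = w
    · rw [h]
    · exact gen_commute (hΓ v w h)
  have h2 : ∀ w z, gen Γ w * z = z * gen Γ w := fun w z => by
    have : Subgroup.closure (Set.range (gen Γ)) ≤ Subgroup.centralizer {gen Γ w} := by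
      rw [Subgroup.closure_le]
      rintro _ ⟨v, rfl⟩
      exact Subgroup.mem_centralizer_singleton_iff.mpr (h1 v w)
    exact (Subgroup.mem_centralizer_singleton_iff.mp
      (this (closure_range_gen Γ ▸ Subgroup.mem_top z))).symm
  have : Subgroup.closure (Set.range (gen Γ)) ≤ Subgroup.centralizer {y} := by
    rw [Subgroup.closure_le]
    rintro _ ⟨v, rfl⟩
    exact Subgroup.mem_centralizer_singleton_iff.mpr (h2 v y)
  exact Subgroup.mem_centralizer_singleton_iff.mp
    (this (closure_range_gen Γ ▸ Subgroup.mem_top x))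

/-- The exponents determine the elements of the right-angled Artin group of a finite complete
graph. -/
theorem eq_one_of_exponent_eq_one [Finite V] (hΓ : ∀ v w, v ≠ w → Γ.Adj v w) {x : RAAG Γ}
    (hx : ∀ v, exponent Γ v x = 1) : x = 1 := by
  have := Fintype.ofFinite V
  let : CommGroup (RAAG Γ) := { instGroup Γ with mul_comm := mul_comm_of_forall_adj hΓ }
  have e : ∏ v, (zpowersHom (RAAG Γ) (gen Γ v)).comp (exponent Γ v) = MonoidHom.id (RAAG Γ) := by
    refine hom_ext fun w => ?_
    rw [MonoidHom.finsetProd_apply, Finset.prod_eq_single w]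
    · simp [exponent_gen_self]
    · intro v _ hv
      simp [exponent_gen_of_ne Γ hv.symm]
    · simp
  have := DFunLike.congr_fun e x
  rw [MonoidHom.finsetProd_apply] at this
  simpa [hx] using this.symm

theorem eq_one_of_mem_range_incl [Finite V] {Δ : Set V} (hΔ : Γ.IsClique Δ) {x : RAAG Γ}
    (hx : x ∈ (incl Γ Δ).range) (h : ∀ v ∈ Δ, exponent Γ v x = 1) : x = 1 := by
  obtain ⟨y, rfl⟩ := hx
  rw [eq_one_of_exponent_eq_one (Γ := Γ.induce Δ) (x := y) (
    fun v w hvw => hΔ v.2 w.2 fun e => hvw (Subtype.ext e))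
    fun v => by rw [← exponent_incl, h v v.2], map_one]

open Classical in
/-- An element of `A_s` that commutes with a generator `a` outside `s` does not involve the vertices
of `s` that are not adjacent to `a`: two non-adjacent generators can be sent to the translation
`n ↦ n + 1` of `ℤ`, no power of which commutes with the transposition of `0` and `1`, and to that
transposition. -/
theorem exponent_eq_one_of_commute {s : Set V} {a v : V} (ha : a ∉ s) (hv : v ∈ s)
    (hav : ¬ Γ.Adj a v) {x : RAAG Γ} (hx : x ∈ (incl Γ s).range) (h : Commute x (gen Γ a)) :
    exponent Γ v x = 1 := by
  have hne : a ≠ v := fun e => ha (e ▸ hv)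
  let f : RAAG Γ →* Equiv.Perm ℤ :=
    lift (fun w => if w = v then Equiv.addRight 1 else if w = a then Equiv.swap 0 1 else 1) (by
      intro w w' hww
      by_cases h1 : w = v
      · have h2 : w' ≠ v := fun e => hww.ne (h1.trans e.symm)
        have h3 : w' ≠ a := fun e => hav (e ▸ h1 ▸ hww.symm)
        simp [h2, h3]
      · by_cases h2 : w = a
        · have h3 : w' ≠ v := fun e => hav (e ▸ h2 ▸ hww)
          have h4 : w' ≠ a := fun e => hww.ne (h2.trans e.symm)
          simp [h3, h4]
        · simp [h1, h2])
  have hfa : f (gen Γ a) = Equiv.swap 0 1 := by simp [f, hne]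
  have hfx : f x = Equiv.addRight 1 ^ (exponent Γ v x).toAdd := by
    obtain ⟨y, rfl⟩ := hx
    have : f.comp (incl Γ s) =
        (zpowersHom (Equiv.Perm ℤ) (Equiv.addRight 1)).comp ((exponent Γ v).comp (incl Γ s)) := by
      refine hom_ext fun w => ?_
      by_cases hw : (w : V) = v
      · simp [f, hw, exponent_gen_self]
      · have hwa : (w : V) ≠ a := fun e => ha (e ▸ w.2)
        simp [f, hw, hwa, exponent_gen_of_ne Γ hw]
    exact DFunLike.congr_fun this y
  have hcomm := h.map f
  have hpow : ∀ n m : ℤ, (Equiv.addRight (1 : ℤ) ^ n) m = m + n := fun n => by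
    induction n using Int.induction_on with
    | zero => simp
    | succ n ih =>
      intro m
      rw [zpow_add_one, Equiv.Perm.mul_apply, ih, Equiv.coe_addRight]
      ring
    | pred n ih =>
      intro m
      rw [zpow_sub_one, Equiv.Perm.mul_apply, ih, Equiv.Perm.inv_def, Equiv.addRight_symm,
        Equiv.coe_addRight]
      ring
  rw [hfa, hfx] at hcomm
  set n := (exponent Γ v x).toAdd with hn
  have h0 := Equiv.congr_fun hcomm.eq 0
  simp only [Equiv.Perm.mul_apply, Equiv.swap_apply_left, hpow, zero_add] at h0
  have hn0 : n = 0 := by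
    by_contra hn0
    by_cases hn1 : n = 1
    · rw [hn1, Equiv.swap_apply_right] at h0
      omega
    · rw [Equiv.swap_apply_of_ne_of_ne hn0 hn1] at h0
      omega
  exact Multiplicative.toAdd.injective (hn.symm.trans hn0)

/-- An element of `A_Δ`, with `Δ` a simplex, is trivial if it commutes with a family of
generators outside `Δ` that have no common neighbour in `Δ`. -/
theorem eq_one_of_commute_of_mem_range_incl [Finite V] {Δ : Set V} (hΔ : Γ.IsClique Δ)
    {ι : Type*} {a : ι → V} (ha : ∀ i, a i ∉ Δ) (hnb : ∀ v ∈ Δ, ∃ i, ¬ Γ.Adj (a i) v) {x : RAAG Γ}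
    (hx : x ∈ (incl Γ Δ).range) (h : ∀ i, Commute x (gen Γ (a i))) : x = 1 :=
  eq_one_of_mem_range_incl hΔ hx fun v hv =>
    let ⟨i, hi⟩ := hnb v hv
    exponent_eq_one_of_commute (ha i) hv hi hx (h i)

end RAAG

/-! ### Decompositions of a graph and the splitting of its group -/

namespace IsDecomposition

variable {V : Type u} {Γ : SimpleGraph V} {Δ : Set V} {W : Bool → Set V}
  (hW : IsDecomposition Γ Δ W)
include hW

theorem exists_mem (v : V) : ∃ i, v ∈ W i := by
  have : v ∈ W true ∪ W false := hW.union ▸ Set.mem_univ v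
  exact this.elim (fun h => ⟨true, h⟩) fun h => ⟨false, h⟩

theorem mem_of_mem_of_mem {i : Bool} {v : V} (h : v ∈ W i) (h' : v ∈ W (!i)) : v ∈ Δ := by
  rw [← hW.inter]
  cases i
  · exact ⟨h', h⟩
  · exact ⟨h, h'⟩

theorem exists_mem_of_adj {v w : V} (h : Γ.Adj v w) : ∃ i, v ∈ W i ∧ w ∈ W i := by
  by_cases hv : v ∈ Δ
  · obtain ⟨i, hi⟩ := hW.exists_mem w
    exact ⟨i, hW.subset i hv, hi⟩
  by_cases hw : w ∈ Δ
  · obtain ⟨i, hi⟩ := hW.exists_mem v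
    exact ⟨i, hi, hW.subset i hw⟩
  obtain ⟨i, hi⟩ := hW.exists_mem v
  obtain ⟨j, hj⟩ := hW.exists_mem w
  cases i <;> cases j
  · exact ⟨_, hi, hj⟩
  · exact absurd h.symm (hW.not_adj w ⟨hj, hw⟩ v ⟨hi, hv⟩)
  · exact absurd h (hW.not_adj v ⟨hi, hv⟩ w ⟨hj, hw⟩)
  · exact ⟨_, hi, hj⟩

/-- The universal property of the amalgamated product, for `A_Γ` and its subgroups `A_{W i}`. -/
theorem exists_hom {P : Type*} [Group P] (f : ∀ i, RAAG (Γ.induce (W i)) →* P)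
    (hf : ∀ x, f true (RAAG.inclInduce Γ (hW.subset true) x) =
      f false (RAAG.inclInduce Γ (hW.subset false) x)) :
    ∃ F : RAAG Γ →* P, ∀ i x, F (RAAG.incl Γ (W i) x) = f i x := by
  choose j hj using hW.exists_mem
  have key : ∀ v k (hk : v ∈ W k) i (hi : v ∈ W i),
      f k (RAAG.gen _ ⟨v, hk⟩) = f i (RAAG.gen _ ⟨v, hi⟩) := by
    intro v k hk i hi
    by_cases hki : k = i
    · subst hki; rfl
    · have hv : v ∈ Δ := hW.mem_of_mem_of_mem hi (Bool.eq_not.mpr hki ▸ hk)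
      have := hf (RAAG.gen _ ⟨v, hv⟩)
      rw [RAAG.inclInduce_gen, RAAG.inclInduce_gen] at this
      cases k <;> cases i
      · exact absurd rfl hki
      · exact this.symm
      · exact this
      · exact absurd rfl hki
  let F : RAAG Γ →* P :=
    RAAG.lift (fun v => f (j v) (RAAG.gen _ ⟨v, hj v⟩)) fun v w hvw => by
      obtain ⟨i, hv, hw⟩ := hW.exists_mem_of_adj hvw
      rw [key v _ (hj v) i hv, key w _ (hj w) i hw]
      exact Commute.map (RAAG.gen_commute (by exact hvw)) (f i)
  refine ⟨F, fun i x => DFunLike.congr_fun (RAAG.hom_ext (f := F.comp (RAAG.incl Γ (W i)))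
    fun v => ?_) x⟩
  rw [MonoidHom.comp_apply, RAAG.incl_gen, RAAG.lift_gen]
  exact key v _ (hj v) i v.2

theorem mem_range_incl_iff {x : RAAG Γ} :
    x ∈ (RAAG.incl Γ Δ).range ↔ ∀ i, x ∈ (RAAG.incl Γ (W i)).range := by
  refine ⟨fun h i => RAAG.range_incl_mono Γ (hW.subset i) h, fun h => ?_⟩
  have := RAAG.mem_range_incl_inter Γ (h true) (h false)
  rwa [hW.inter] at this

/-- The normal form theorem for amalgamated products, applied to the image of an alternating product
in the pushout of the groups `A_{W i}`. -/
theorem isAmalgam : IsAmalgam fun i => (RAAG.incl Γ (W i)).range := by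
  classical
  refine ⟨?_, fun i n h => ?_⟩
  · rw [eq_top_iff, ← RAAG.closure_range_gen, Subgroup.closure_le]
    rintro _ ⟨v, rfl⟩
    obtain ⟨i, hi⟩ := hW.exists_mem v
    cases i
    · exact Subgroup.mem_sup_right (RAAG.gen_mem_range_incl Γ hi)
    · exact Subgroup.mem_sup_left (RAAG.gen_mem_range_incl Γ hi)
  · let φ : ∀ i, RAAG (Γ.induce Δ) →* RAAG (Γ.induce (W i)) := fun i =>
      RAAG.inclInduce Γ (hW.subset i)
    obtain ⟨F, hF⟩ := hW.exists_hom (P := Monoid.PushoutI φ)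
        (fun i => Monoid.PushoutI.of (φ := φ) i)
      fun x => (Monoid.PushoutI.of_apply_eq_base φ true x).trans
        (Monoid.PushoutI.of_apply_eq_base φ false x).symm
    have key : ∀ n i x, IsAlternatingProd (fun i => (RAAG.incl Γ (W i)).range) i n x →
        ∃ w : Monoid.CoprodI.Word fun i => RAAG (Γ.induce (W i)),
          Monoid.PushoutI.Reduced φ w ∧ Monoid.PushoutI.ofCoprodI w.prod = F x ∧
          w.fstIdx ≠ some (!i) ∧ w.toList.length = n := by
      intro n
      induction n with
      | zero =>
        rintro i x rfl
        exact ⟨.empty, by simp [Monoid.PushoutI.Reduced, Monoid.CoprodI.Word.empty], by simp,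
          by simp [Monoid.CoprodI.Word.empty, Monoid.CoprodI.Word.fstIdx], rfl⟩
      | succ n ih =>
        rintro i _ ⟨_, y, ⟨c, rfl⟩, hc, hy, rfl⟩
        obtain ⟨w, hw, hwy, hfst, hlen⟩ := ih _ _ hy
        rw [Bool.not_not] at hfst
        have hcφ : c ∉ (φ i).range := by
          rintro ⟨d, rfl⟩
          refine hc ⟨RAAG.inclInduce Γ (hW.subset (!i)) d, ?_⟩
          rw [RAAG.incl_inclInduce, RAAG.incl_inclInduce]
        have hc1 : c ≠ 1 := fun e => hcφ (e ▸ one_mem _)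
        refine ⟨.cons c w hfst hc1, ?_, ?_, ?_, ?_⟩
        · intro g hg
          rcases List.mem_cons.mp hg with rfl | hg
          · exact hcφ
          · exact hw g hg
        · rw [Monoid.CoprodI.Word.prod_cons, map_mul, hwy, map_mul, hF,
            Monoid.PushoutI.ofCoprodI_of]
        · rw [Monoid.CoprodI.Word.fstIdx_cons]
          exact fun e => Bool.not_ne_self i (Option.some.inj e).symm
        · simp [Monoid.CoprodI.Word.cons, hlen]
    obtain ⟨w, hw, hw1, -, hlen⟩ := key _ _ _ h
    have := hw.eq_empty_of_mem_range (fun i => RAAG.inclInduce_injective Γ (hW.subset i))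
      (by rw [hw1, map_one]; exact one_mem _)
    rw [this] at hlen
    exact absurd hlen (by simp [Monoid.CoprodI.Word.empty])

end IsDecomposition

/-! ### Transport along isomorphisms -/

section Transport

variable {G G' : Type*} [Group G] [Group G']

theorem IsAlternatingProd.map_comap {H : Bool → Subgroup G'} (f : G →* G') :
    ∀ {n : ℕ} {i : Bool} {x : G}, IsAlternatingProd (fun i => (H i).comap f) i n x →
      IsAlternatingProd H i n (f x)
  | 0, _, _, h => by
    obtain rfl := h
    exact map_one f
  | _ + 1, _, _, ⟨c, y, hc, hc', hy, h⟩ => ⟨f c, f y, hc, hc', hy.map_comap f, by rw [h, map_mul]⟩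

theorem IsAmalgam.comap {H : Bool → Subgroup G'} (hH : IsAmalgam H) (e : G ≃* G') :
    IsAmalgam fun i => (H i).comap e.toMonoidHom where
  sup_eq_top := by
    refine (Subgroup.comap_sup_eq e.toMonoidHom _ _ e.surjective).trans ?_
    rw [hH.sup_eq_top, Subgroup.comap_top]
  not_isAlternatingProd_one i n h :=
    hH.not_isAlternatingProd_one i n (by simpa using h.map_comap e.toMonoidHom)

theorem map_prefixProd (f : G →* G') (c : ℕ → G) (n : ℕ) :
    f (prefixProd c n) = prefixProd (fun k => f (c k)) n := by
  induction n with
  | zero => exact map_one f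
  | succ n ih => rw [prefixProd, map_mul, ih, prefixProd]

end Transport

/-! ### The Bass–Serre tree of the splitting -/

namespace IsDecomposition

open GraphOfGroups

variable {V : Type u} {Γ : SimpleGraph V} {Δ : Set V} {W : Bool → Set V}
  (hW : IsDecomposition Γ Δ W)

theorem isSpanningTree_raagSplitting : (raagSplitting Γ hW).IsSpanningTree Set.univ where
  not_loop _ _ := Bool.noConfusion
  injOn _ _ _ _ _ := rfl
  isTree := by
    refine ⟨⟨?_⟩, .of_card_le_two (by simp)⟩
    have key : (SimpleGraph.fromEdgeSet
        ((fun e => s((raagSplitting Γ hW).o e, (raagSplitting Γ hW).t e)) '' Set.univ)).Adj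
        true false := by
      rw [SimpleGraph.fromEdgeSet_adj]
      exact ⟨⟨(), trivial, rfl⟩, Bool.noConfusion⟩
    intro i j
    cases i <;> cases j
    · rfl
    · exact key.symm.reachable
    · exact key.reachable
    · rfl

theorem stable_raagSplitting (e : Unit) : (raagSplitting Γ hW).stable Set.univ e = 1 :=
  (QuotientGroup.eq_one_iff _).mpr (Subgroup.subset_normalClosure (Or.inr ⟨e, trivial, rfl⟩))

theorem ofVertex_inclInduce (x : RAAG (Γ.induce Δ)) :
    (raagSplitting Γ hW).ofVertex Set.univ true (RAAG.inclInduce Γ (hW.subset true) x) =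
      (raagSplitting Γ hW).ofVertex Set.univ false (RAAG.inclInduce Γ (hW.subset false) x) := by
  let 𝒢 := raagSplitting Γ hW
  have h : 𝒢.mkFund Set.univ (𝒢.preStable () * 𝒢.preVertex (𝒢.t ()) (𝒢.toT () x) *
      (𝒢.preStable ())⁻¹ * (𝒢.preVertex (𝒢.o ()) (𝒢.toO () x))⁻¹) = 1 :=
    (QuotientGroup.eq_one_iff _).mpr (Subgroup.subset_normalClosure (Or.inl ⟨(), x, rfl⟩))
  have hs : 𝒢.mkFund Set.univ (𝒢.preStable ()) = 1 := stable_raagSplitting hW ()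
  rw [map_mul, map_mul, map_mul, map_inv, map_inv, hs, one_mul, inv_one, mul_one,
    mul_inv_eq_one] at h
  exact h.symm

/-- The fundamental group of the splitting is `A_Γ`. -/
theorem exists_fundGroup_equiv :
    ∃ φ : (raagSplitting Γ hW).FundGroup Set.univ ≃* RAAG Γ,
      ∀ (i : Bool) (x : RAAG (Γ.induce (W i))),
        φ ((raagSplitting Γ hW).ofVertex Set.univ i x) = RAAG.incl Γ (W i) x := by
  let 𝒢 := raagSplitting Γ hW
  let f₀ : 𝒢.PreGroup →* RAAG Γ :=
    Monoid.Coprod.lift (Monoid.CoprodI.lift fun i => RAAG.incl Γ (W i)) 1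
  have hv : ∀ i x, f₀ (𝒢.preVertex i x) = RAAG.incl Γ (W i) x := fun i x => by
    change f₀ (Monoid.Coprod.inl (Monoid.CoprodI.of x)) = _
    rw [Monoid.Coprod.lift_apply_inl]
    exact Monoid.CoprodI.lift_of _ _
  have hst : ∀ e, f₀ (𝒢.preStable e) = 1 := fun e => by
    change f₀ (Monoid.Coprod.inr _) = _
    rw [Monoid.Coprod.lift_apply_inr, MonoidHom.one_apply]
  have hker : Subgroup.normalClosure (𝒢.relators Set.univ) ≤ f₀.ker := by
    refine Subgroup.normalClosure_le_normal ?_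
    rintro _ (⟨e, c, rfl⟩ | ⟨e, -, rfl⟩)
    · rw [SetLike.mem_coe, MonoidHom.mem_ker, map_mul, map_mul, map_mul, map_inv, map_inv, hst, hv,
        hv, one_mul, inv_one, mul_one, mul_inv_eq_one]
      exact (RAAG.incl_inclInduce Γ (hW.subset false) c).trans
        (RAAG.incl_inclInduce Γ (hW.subset true) c).symm
    · exact hst e
  let f : 𝒢.FundGroup Set.univ →* RAAG Γ := QuotientGroup.lift _ f₀ hker
  obtain ⟨F, hF⟩ := hW.exists_hom (𝒢.ofVertex Set.univ) hW.ofVertex_inclInduce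
  have hf : ∀ i x, f (𝒢.ofVertex Set.univ i x) = RAAG.incl Γ (W i) x := hv
  have hFf : (F.comp f).comp (𝒢.mkFund Set.univ) = 𝒢.mkFund Set.univ := by
    refine Monoid.Coprod.hom_ext (Monoid.CoprodI.ext_hom _ _ fun i => MonoidHom.ext fun x => ?_)
      (FreeGroup.ext_hom _ _ fun e => ?_)
    · exact (congrArg F (hf i x)).trans (hF i x)
    · refine (congrArg F (hst e)).trans ((map_one F).trans ?_)
      exact (hW.stable_raagSplitting e).symm
  refine ⟨MulEquiv.ofBijective f ⟨?_, ?_⟩, hf⟩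
  · refine Function.LeftInverse.injective (g := F) fun x => ?_
    obtain ⟨y, rfl⟩ := QuotientGroup.mk'_surjective _ x
    exact DFunLike.congr_fun hFf y
  · rw [← MonoidHom.range_eq_top, eq_top_iff, ← RAAG.closure_range_gen, Subgroup.closure_le]
    rintro _ ⟨v, rfl⟩
    obtain ⟨i, hi⟩ := hW.exists_mem v
    exact ⟨𝒢.ofVertex Set.univ i (RAAG.gen _ ⟨v, hi⟩), (hf i _).trans (RAAG.incl_gen ..)⟩

theorem bassSerreTree_eq_cosetGraph :
    (raagSplitting Γ hW).bassSerreTree Set.univ =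
      cosetGraph ((raagSplitting Γ hW).vertexSubgroup Set.univ) := by
  have key : ∀ x y : (raagSplitting Γ hW).BassSerreVertex Set.univ,
      (∃ (g : (raagSplitting Γ hW).FundGroup Set.univ) (e : Unit),
        x = ⟨(raagSplitting Γ hW).o e, g⟩ ∧ y = ⟨(raagSplitting Γ hW).t e,
          ((g * (raagSplitting Γ hW).stable Set.univ e :
            (raagSplitting Γ hW).FundGroup Set.univ) : _ ⧸ _)⟩) ↔
      ∃ g : (raagSplitting Γ hW).FundGroup Set.univ, x = ⟨true, g⟩ ∧ y = ⟨false, g⟩ := by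
    intro x y
    constructor
    · rintro ⟨g, e, rfl, rfl⟩
      exact ⟨g, rfl, by rw [stable_raagSplitting, mul_one]; rfl⟩
    · rintro ⟨g, rfl, rfl⟩
      exact ⟨g, (), rfl, by rw [stable_raagSplitting, mul_one]; rfl⟩
  ext x y
  rw [bassSerreTree, SimpleGraph.fromRel_adj, key, key, cosetGraph_adj]
  constructor
  · rintro ⟨-, ⟨g, rfl, rfl⟩ | ⟨g, rfl, rfl⟩⟩
    · exact ⟨true, g, rfl, rfl⟩
    · exact ⟨false, g, rfl, rfl⟩
  · rintro ⟨i, g, rfl, rfl⟩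
    refine ⟨fun h => Bool.not_ne_self i (congrArg Sigma.fst h).symm, ?_⟩
    cases i
    · exact Or.inr ⟨g, rfl, rfl⟩
    · exact Or.inl ⟨g, rfl, rfl⟩

section Action

variable {φ : (raagSplitting Γ hW).FundGroup Set.univ ≃* RAAG Γ}
  (hφ : ∀ (i : Bool) (x : RAAG (Γ.induce (W i))),
    φ ((raagSplitting Γ hW).ofVertex Set.univ i x) = RAAG.incl Γ (W i) x)

include hφ

theorem mem_vertexSubgroup_iff {i : Bool} {x : (raagSplitting Γ hW).FundGroup Set.univ} :
    x ∈ (raagSplitting Γ hW).vertexSubgroup Set.univ i ↔ φ x ∈ (RAAG.incl Γ (W i)).range := by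
  constructor
  · rintro ⟨y, rfl⟩
    exact ⟨y, (hφ i y).symm⟩
  · rintro ⟨y, hy⟩
    exact ⟨y, φ.injective ((hφ i y).trans hy)⟩

theorem isAmalgam_vertexSubgroup :
    IsAmalgam ((raagSplitting Γ hW).vertexSubgroup Set.univ) := by
  have := hW.isAmalgam.comap φ
  convert this using 2 with i
  ext x
  exact hW.mem_vertexSubgroup_iff hφ

theorem map_edgeSubgroup (e : Unit) :
    ((raagSplitting Γ hW).edgeSubgroup Set.univ e).map φ.toMonoidHom = (RAAG.incl Γ Δ).range := by
  rw [edgeSubgroup, MonoidHom.map_range]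
  congr 1
  refine MonoidHom.ext fun x => ?_
  exact (hφ true _).trans (RAAG.incl_inclInduce Γ (hW.subset true) x)

variable {s : ℕ → Bool} {v : ℕ → V} (hs : ∀ n, s (n + 1) = !s n) (hv : ∀ n, v n ∈ W (s n) \ Δ)
  {L : ℕ} (hL : 0 < L) (hsL : ∀ n, s (n + L) = s n) (hvL : ∀ n, v (n + L) = v n)
include hs hv hL hsL hvL

/-- A product of generators that lie alternately on the two sides of a decomposition acts
loxodromically on the Bass–Serre tree. -/
theorem isLoxodromic_prod_gen : IsLoxodromic ((raagSplitting Γ hW).bassSerreTree Set.univ)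
    (φ.symm (prefixProd (fun n => RAAG.gen Γ (v n)) L)) := by
  rw [bassSerreTree_eq_cosetGraph, ← MulEquiv.coe_toMonoidHom, map_prefixProd]
  refine isLoxodromic_prefixProd hs (fun n => ?_) (fun n => ?_) hL hsL (fun n => by rw [hvL])
    (hW.isAmalgam_vertexSubgroup hφ)
  · rw [hW.mem_vertexSubgroup_iff hφ]
    simpa using RAAG.gen_mem_range_incl Γ (hv n).1
  · rw [hW.mem_vertexSubgroup_iff hφ]
    simpa using RAAG.gen_notMem_range_incl Γ
      fun h => (hv n).2 (hW.mem_of_mem_of_mem (hv n).1 h)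

/-- A product of generators that lie alternately on the two sides of a decomposition along a simplex
is WPD if no vertex of the simplex is adjacent to all of them. -/
theorem isWPD_prod_gen [Finite V] (hΔ : Γ.IsClique Δ)
    (hnb : ∀ w ∈ Δ, ∃ n < L, ¬ Γ.Adj (v n) w) :
    IsWPD ((raagSplitting Γ hW).bassSerreTree Set.univ)
      (φ.symm (prefixProd (fun n => RAAG.gen Γ (v n)) L)) := by
  rw [bassSerreTree_eq_cosetGraph, ← MulEquiv.coe_toMonoidHom, map_prefixProd]
  have hmem : ∀ x : (raagSplitting Γ hW).FundGroup Set.univ,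
      (∀ i, x ∈ (raagSplitting Γ hW).vertexSubgroup Set.univ i) → φ x ∈ (RAAG.incl Γ Δ).range :=
    fun x hx => hW.mem_range_incl_iff.mpr fun i => (hW.mem_vertexSubgroup_iff hφ).mp (hx i)
  refine isWPD_prefixProd hs (fun n => ?_) (fun n => ?_) hL hsL (fun n => by rw [hvL])
    (hW.isAmalgam_vertexSubgroup hφ) (fun n k hk hk' => ?_) (fun k hk hcomm => ?_)
  · rw [hW.mem_vertexSubgroup_iff hφ]
    simpa using RAAG.gen_mem_range_incl Γ (hv n).1
  · rw [hW.mem_vertexSubgroup_iff hφ]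
    simpa using RAAG.gen_notMem_range_incl Γ
      fun h => (hv n).2 (hW.mem_of_mem_of_mem (hv n).1 h)
  · apply φ.injective
    have := RAAG.conj_gen_eq_of_mem Γ (hv n).2 (hmem k hk) (by simpa using hmem _ hk')
    simpa using this
  · apply φ.injective
    rw [map_one]
    refine RAAG.eq_one_of_commute_of_mem_range_incl hΔ (a := fun n : Fin L => v n)
      (fun n => (hv n).2) (fun w hw => ?_) (hmem k hk) fun n => ?_
    · obtain ⟨n, hn, h⟩ := hnb w hw
      exact ⟨⟨n, hn⟩, h⟩
    · have := (hcomm n n.2).map φ.toMonoidHom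
      simpa using this

end Action

end IsDecomposition

/-! ### Choosing the decomposition and the generators -/

section Graph

variable {V : Type u} {Γ : SimpleGraph V} {Δ : Set V} {W : Bool → Set V}

/-- The connected component of `a` in `Γ ∖ Δ` and the union of the other components give a
decomposition along `Δ`. -/
theorem exists_isDecomposition {a b : (Δᶜ : Set V)} (h : ¬ (Γ.induce Δᶜ).Reachable a b) :
    ∃ W : Bool → Set V, IsDecomposition Γ Δ W ∧ (a : V) ∈ W true ∧ (b : V) ∈ W false := by
  let C : Set V := {v | ∃ hv : v ∈ Δᶜ, (Γ.induce Δᶜ).Reachable a ⟨v, hv⟩}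
  have ha : (a : V) ∈ C := ⟨a.2, .refl _⟩
  have hb : (b : V) ∉ C := fun ⟨_, hb⟩ => h hb
  have hC : ∀ v ∈ C, v ∉ Δ := fun v hv => hv.1
  refine ⟨fun i => cond i (Δ ∪ C) Cᶜ, ⟨?_, ?_, ?_, ?_⟩, Or.inr ha, hb⟩
  · ext v
    by_cases hv : v ∈ C <;> simp [hv]
  · ext v
    simp only [cond_true, cond_false, Set.mem_inter_iff, Set.mem_union, Set.mem_compl_iff]
    exact ⟨fun hv => hv.1.resolve_right hv.2, fun hv => ⟨Or.inl hv, fun hv' => hC v hv' hv⟩⟩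
  · rintro (_ | _)
    · exact ⟨b, hb, b.2⟩
    · exact ⟨a, Or.inr ha, a.2⟩
  · rintro v ⟨hv, hvΔ⟩ w ⟨hw, hwΔ⟩ hvw
    obtain ⟨_, hav⟩ := hv.resolve_left hvΔ
    exact hw ⟨hwΔ, hav.trans (SimpleGraph.Adj.reachable (by exact hvw))⟩

/-- Two vertices at distance at least three yield two vertices `x`, `y` on one side of the
decomposition and a vertex `b` on the other side without a common neighbour in the simplex. -/
theorem IsDecomposition.exists_no_common_neighbour (hW : IsDecomposition Γ Δ W)
    (hΔ : Γ.IsClique Δ) (hdiam : 3 ≤ Γ.ediam) :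
    ∃ i, ∃ x ∈ W i \ Δ, ∃ y ∈ W i \ Δ, ∃ b ∈ W (!i) \ Δ,
      ∀ w ∈ Δ, ¬ (Γ.Adj x w ∧ Γ.Adj b w ∧ Γ.Adj y w) := by
  obtain ⟨x, y, hxy⟩ : ∃ x y, 2 < Γ.edist x y := by
    by_contra! h
    have := hdiam.trans (SimpleGraph.ediam_le_of_edist_le h)
    exact absurd this (by decide)
  obtain ⟨hne, hnadj, hcn⟩ := SimpleGraph.two_lt_edist_iff.mp hxy
  have hno : ∀ w, Γ.Adj x w → Γ.Adj y w → False := fun w h h' => by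
    have : w ∈ Γ.commonNeighbors x y := ⟨h, h'⟩
    rwa [hcn] at this
  obtain ⟨i, hx⟩ := hW.exists_mem x
  obtain ⟨j, hy⟩ := hW.exists_mem y
  by_cases hxΔ : x ∈ Δ
  · have hyΔ : y ∉ Δ := fun hyΔ => hnadj (hΔ hxΔ hyΔ hne)
    obtain ⟨b, hb⟩ := hW.nonempty (!j)
    refine ⟨j, y, ⟨hy, hyΔ⟩, y, ⟨hy, hyΔ⟩, b, hb, fun w hw ⟨h, _, _⟩ => ?_⟩
    by_cases hxw : x = w
    · exact hnadj (hxw ▸ h.symm)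
    · exact hno w (hΔ hxΔ hw hxw) h
  by_cases hyΔ : y ∈ Δ
  · obtain ⟨b, hb⟩ := hW.nonempty (!i)
    refine ⟨i, x, ⟨hx, hxΔ⟩, x, ⟨hx, hxΔ⟩, b, hb, fun w hw ⟨h, _, _⟩ => ?_⟩
    by_cases hyw : y = w
    · exact hnadj (hyw ▸ h)
    · exact hno w h (hΔ hyΔ hw hyw)
  by_cases hij : j = i
  · subst hij
    obtain ⟨b, hb⟩ := hW.nonempty (!j)
    exact ⟨j, x, ⟨hx, hxΔ⟩, y, ⟨hy, hyΔ⟩, b, hb, fun w _ ⟨h, _, h'⟩ => hno w h h'⟩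
  · exact ⟨i, x, ⟨hx, hxΔ⟩, x, ⟨hx, hxΔ⟩, y, ⟨Bool.eq_not.mpr hij ▸ hy, hyΔ⟩,
      fun w _ ⟨h, h', _⟩ => hno w h h'⟩

/-- The product `x b y b` for suitable generators is loxodromic and WPD on the Bass–Serre tree. -/
theorem IsDecomposition.exists_isLoxodromic_isWPD [Finite V] (hW : IsDecomposition Γ Δ W)
    (hΔ : Γ.IsClique Δ) (hdiam : 3 ≤ Γ.ediam)
    {φ : (raagSplitting Γ hW).FundGroup Set.univ ≃* RAAG Γ}
    (hφ : ∀ (i : Bool) (x : RAAG (Γ.induce (W i))),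
      φ ((raagSplitting Γ hW).ofVertex Set.univ i x) = RAAG.incl Γ (W i) x) :
    ∃ g : RAAG Γ, IsLoxodromic ((raagSplitting Γ hW).bassSerreTree Set.univ) (φ.symm g) ∧
      IsWPD ((raagSplitting Γ hW).bassSerreTree Set.univ) (φ.symm g) := by
  obtain ⟨i, x, hx, y, hy, b, hb, hno⟩ := hW.exists_no_common_neighbour hΔ hdiam
  let s : ℕ → Bool := fun n => if n % 2 = 0 then i else !i
  let v : ℕ → V := fun n => if n % 4 = 0 then x else if n % 4 = 2 then y else b
  have hs : ∀ n, s (n + 1) = !s n := fun n => by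
    rcases Nat.mod_two_eq_zero_or_one n with h | h <;> simp [s, h, Nat.add_mod]
  have hv : ∀ n, v n ∈ W (s n) \ Δ := fun n => by
    have h4 : n % 4 % 2 = n % 2 := Nat.mod_mod_of_dvd n (by norm_num)
    have hlt : n % 4 < 4 := Nat.mod_lt _ (by norm_num)
    simp only [v, s, ← h4]
    generalize n % 4 = k at hlt
    interval_cases k <;> simpa
  have hsL : ∀ n, s (n + 4) = s n := fun n => by simp [s, Nat.add_mod]
  have hvL : ∀ n, v (n + 4) = v n := fun n => by simp [v]
  refine ⟨_, hW.isLoxodromic_prod_gen hφ hs hv (by norm_num) hsL hvL,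
    hW.isWPD_prod_gen hφ hs hv (by norm_num) hsL hvL hΔ fun w hw => ?_⟩
  by_contra! h
  exact hno w hw ⟨by simpa [v] using h 0, by simpa [v] using h 1, by simpa [v] using h 2⟩

end Graph

/-! ### Splittings of right-angled Artin groups along simplices -/

theorem lemma4p3 {V : Type u} [Finite V] (Γ : SimpleGraph V)
    (Δ : Set V) (hΔ : IsSeparatingSimplex Γ Δ) (hdiam : 3 ≤ Γ.ediam) :
    SatisfiesGraphAssumption (RAAG Γ) ∧
    (∀ x y : RAAG (Γ.induce Δ), x * y = y * x) ∧
    Function.Injective (RAAG.incl Γ Δ) ∧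
    IsUndistorted (RAAG.incl Γ Δ).range ∧
    HasAmbientSubexponentialGrowth (RAAG.incl Γ Δ).range ∧
    (∀ a b : (Δᶜ : Set V), ¬ (Γ.induce Δᶜ).Reachable a b →
      ∃ W : Bool → Set V, IsDecomposition Γ Δ W ∧ (a : V) ∈ W true ∧ (b : V) ∈ W false) ∧
    ∀ (W : Bool → Set V) (hW : IsDecomposition Γ Δ W),
      (raagSplitting Γ hW).IsSpanningTree Set.univ ∧
      ((raagSplitting Γ hW).bassSerreTree Set.univ).IsTree ∧
      ∃ φ : (raagSplitting Γ hW).FundGroup Set.univ ≃* RAAG Γ,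
        (∀ (i : Bool) (x : RAAG (Γ.induce (W i))),
          φ ((raagSplitting Γ hW).ofVertex Set.univ i x) = RAAG.incl Γ (W i) x) ∧
        (∃ g : RAAG Γ,
          IsLoxodromic ((raagSplitting Γ hW).bassSerreTree Set.univ) (φ.symm g) ∧
          IsWPD ((raagSplitting Γ hW).bassSerreTree Set.univ) (φ.symm g)) ∧
        ∀ a ∈ W true \ Δ, ∀ b ∈ W false \ Δ,
          IsLoxodromic ((raagSplitting Γ hW).bassSerreTree Set.univ)
            (φ.symm (RAAG.gen Γ a * RAAG.gen Γ b)) ∧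
          ((∀ v, ¬ (Γ.Adj a v ∧ Γ.Adj b v)) →
            IsWPD ((raagSplitting Γ hW).bassSerreTree Set.univ)
              (φ.symm (RAAG.gen Γ a * RAAG.gen Γ b))) := by
  obtain ⟨hclique, hsep⟩ := hΔ
  have hgrowth : HasAmbientSubexponentialGrowth (RAAG.incl Γ Δ).range :=
    .of_hom_int (fun v : Δ => RAAG.exponent Γ v) fun x hx h =>
      RAAG.eq_one_of_mem_range_incl hclique hx fun v hv => h ⟨v, hv⟩
  have hdec : ∀ a b : (Δᶜ : Set V), ¬ (Γ.induce Δᶜ).Reachable a b →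
      ∃ W : Bool → Set V, IsDecomposition Γ Δ W ∧ (a : V) ∈ W true ∧ (b : V) ∈ W false :=
    fun _ _ => exists_isDecomposition
  refine ⟨⟨RAAG.fg Γ, ?_⟩, ?_, RAAG.incl_injective Γ Δ, ?_, hgrowth, hdec, fun W hW => ?_⟩
  · simp only [SimpleGraph.Preconnected, not_forall] at hsep
    obtain ⟨a, b, hab⟩ := hsep
    obtain ⟨W, hW, -, -⟩ := hdec a b hab
    obtain ⟨φ, hφ⟩ := hW.exists_fundGroup_equiv
    exact ⟨Bool, Unit, inferInstance, inferInstance, raagSplitting Γ hW, Set.univ, φ,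
      hW.isSpanningTree_raagSplitting, fun e => by rwa [hW.map_edgeSubgroup hφ],
      hW.exists_isLoxodromic_isWPD hclique hdiam hφ⟩
  · exact RAAG.mul_comm_of_forall_adj fun v w hvw =>
      hclique v.2 w.2 fun e => hvw (Subtype.ext e)
  · have := RAAG.fg (Γ.induce Δ)
    refine .of_retraction ((Group.fg_iff_subgroup_fg _).mp inferInstance)
      ((RAAG.incl Γ Δ).rangeRestrict.comp (RAAG.retract Γ Δ)) fun h => Subtype.ext ?_
    exact RAAG.incl_retract_of_mem Γ h.2
  · obtain ⟨φ, hφ⟩ := hW.exists_fundGroup_equiv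
    refine ⟨hW.isSpanningTree_raagSplitting, ?_, φ, hφ,
      hW.exists_isLoxodromic_isWPD hclique hdiam hφ, fun a ha b hb => ?_⟩
    · rw [hW.bassSerreTree_eq_cosetGraph]
      exact (hW.isAmalgam_vertexSubgroup hφ).isTree_cosetGraph
    let s : ℕ → Bool := fun n => if n % 2 = 0 then true else false
    let v : ℕ → V := fun n => if n % 2 = 0 then a else b
    have hs : ∀ n, s (n + 1) = !s n := fun n => by
      rcases Nat.mod_two_eq_zero_or_one n with h | h <;> simp [s, h, Nat.add_mod]
    have hv : ∀ n, v n ∈ W (s n) \ Δ := fun n => by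
      rcases Nat.mod_two_eq_zero_or_one n with h | h <;> simpa [s, v, h]
    have hsL : ∀ n, s (n + 2) = s n := fun n => by simp [s]
    have hvL : ∀ n, v (n + 2) = v n := fun n => by simp [v]
    have hab : RAAG.gen Γ a * RAAG.gen Γ b = prefixProd (fun n => RAAG.gen Γ (v n)) 2 := by
      simp [prefixProd, v]
    rw [hab]
    refine ⟨hW.isLoxodromic_prod_gen hφ hs hv (by norm_num) hsL hvL, fun hno =>
      hW.isWPD_prod_gen hφ hs hv (by norm_num) hsL hvL hclique fun w _ => ?_⟩
    by_contra! h
    exact hno w ⟨by simpa [v] using h 0, by simpa [v] using h 1⟩
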